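/- Let $G$ be a second countable, locally compact Hausdorff topological group with a left Haar measure $dg$, and let $P\subset G$ be a closed subsemigroup containing the identity such that $G=PP^{-1}$ and the interior of $P$ is dense in $P$. Let $V:P\to B(\mathcal H)$ be an isometric representation on a Hilbert space $\mathcal H$ with commuting range projections: each $V_a$ is an isometry, $V_aV_b=V_{ba}$, the maps $a\mapsto V_a$ and $a\mapsto V_a^*$ are strongly continuous, and the projections $V_aV_a^*$ ($a\in P$) commute with each other. For $g=ab^{-1}\in G$ with $a,b\in P$ put $W_g:=V_b^*V_a$ (this does not depend on the choice of $a,b$) and $E_g:=W_gW_g^*$; for $f\in L^1(G)$ put $E_f:=\int f(g)E_g\,dg$ (strong integral), and let $\mathcal A\subset B(\mathcal H)$ be the $C^*$-algebra generated by $\{E_f: f\in L^1(G)\}$. The support of a character $\chi$ of $\mathcal A$ is the closed set $A_\chi\subset G$ such that $g\notin A_\chi$ if and only if there is an open set $U\ni g$ with $\chi(E_f)=0$ for every $f\in C_c(G)$ with $\operatorname{supp} f\subset U$. Let $\mathcal C(G)$ be the space of closed subsets of $G$ with the compact Vietoris (Fell) topology, generated by the sets $\{A: A\cap U\neq\emptyset\}$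 ($U$ open) and $\{A: A\cap K=\emptyset\}$ ($K$ compact). The spectrum of $\mathcal A$ is regarded, via $\chi\mapsto A_\chi$, as the subspace $\Omega:=\{A_\chi:\chi \text{ a character of }\mathcal A\}$ of $\mathcal C(G)$, and $P$ acts on it by right translation $A\cdot a=Aa=\{xa:x\in A\}$. The semidirect product groupoid is $$\Omega\rtimes P=\{(A,g,B)\in\Omega\times G\times\Omega:\ \exists\, a,b\in P,\ g=ab^{-1},\ Aa=Bb\},$$ with unit space $\Omega$, range $r(A,g,B)=A$, source $s(A,g,B)=B$, product $(A,g,B)(B,h,C)=(A,gh,C)$ and inverse $(A,g,B)^{-1}=(B,g^{-1},A)$. Since $B$ is determined by $(A,g)$, it is regarded as a subset of $\Omega\times G$ and given the subspace topology. For $A\in\Omega$ let $Q_A:=\{g\in G:(A,g)\in\Omega\rtimes P\}$. Then: 1. For all $A\in\Omega$ and $g\in G$: $Ag\in\Omega$ if and only if $g^{-1}\in A$. 2. $\Omega\rtimes P$ is a locally compact Hausdorff topological groupoid, and it has a Haar system, given by the measures $\lambda^A=1_{Q_A}(g)\,dg$ ($A\in\Omega$) on $\{A\}\times Q_A=r^{-1}(A)$.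 That is: each $\lambda^A$, as a measure on $\Omega\rtimes P$, is a Radon measure with support exactly $r^{-1}(A)$; for every $f\in C_c(\Omega\rtimes P)$ the function $A\mapsto\int f\,d\lambda^A$ is continuous on $\Omega$; and for every $\gamma\in\Omega\rtimes P$ and $f\in C_c(\Omega\rtimes P)$, $\int f(\gamma\eta)\,d\lambda^{s(\gamma)}(\eta)=\int f(\eta)\,d\lambda^{r(\gamma)}(\eta)$. -/

import Mathlib

open MeasureTheory Topology

noncomputable section

namespace IsometricRep

/-! ## Groupoids and Haar systems -/

/-- A groupoid with unit space `X` and set of arrows `𝒢`. The product `γ η` is defined exactly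
when the source of `γ` is the range of `η`. -/
structure GroupoidStr (X 𝒢 : Type*) where
  r : 𝒢 → X
  s : 𝒢 → X
  unit : X → 𝒢
  inv : 𝒢 → 𝒢
  mul : (γ η : 𝒢) → s γ = r η → 𝒢
  r_unit : ∀ x, r (unit x) = x
  s_unit : ∀ x, s (unit x) = x
  r_inv : ∀ γ, r (inv γ) = s γ
  s_inv : ∀ γ, s (inv γ) = r γ
  r_mul : ∀ γ η h, r (mul γ η h) = r γ
  s_mul : ∀ γ η h, s (mul γ η h) = s η
  mul_assoc : ∀ γ η ζ (h₁ : s γ = r η) (h₂ : s η = r ζ),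
    mul (mul γ η h₁) ζ ((s_mul γ η h₁).trans h₂) = mul γ (mul η ζ h₂) (h₁.trans (r_mul η ζ h₂).symm)
  unit_mul : ∀ γ, mul (unit (r γ)) γ (s_unit (r γ)) = γ
  mul_unit : ∀ γ, mul γ (unit (s γ)) (r_unit (s γ)).symm = γ
  mul_inv : ∀ γ, mul γ (inv γ) (r_inv γ).symm = unit (r γ)
  inv_mul : ∀ γ, mul (inv γ) γ (s_inv γ) = unit (s γ)

/-- `𝒢`, with the given topologies on arrows and units, is a locally compact Hausdorff
topological groupoid. -/
structure GroupoidStr.IsLocallyCompactGroupoid {X 𝒢 : Type*} [TopologicalSpace X]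
    [TopologicalSpace 𝒢] (S : GroupoidStr X 𝒢) : Prop where
  locallyCompact : LocallyCompactSpace 𝒢
  hausdorff : T2Space 𝒢
  continuous_r : Continuous S.r
  continuous_s : Continuous S.s
  continuous_unit : Continuous S.unit
  continuous_inv : Continuous S.inv
  continuous_mul : Continuous
    (fun p : {p : 𝒢 × 𝒢 // S.s p.1 = S.r p.2} => S.mul p.1.1 p.1.2 p.2)

open Classical in
/-- A (left) Haar system on a topological groupoid: a family of Radon measures `lam x`, `x ∈ X`,
with support exactly `r ⁻¹ {x}`, such that `x ↦ ∫ f d(lam x)` is continuous for every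
`f ∈ C_c(𝒢)`, and such that
`∫ f (γ η) d(lam (s γ))(η) = ∫ f d(lam (r γ))` for every `γ ∈ 𝒢` and `f ∈ C_c(𝒢)`.
(`lam (s γ)` lives on `r ⁻¹ {s γ}`, where `γ η` is defined; elsewhere the integrand is put to be
zero.) -/
structure GroupoidStr.IsHaarSystem {X 𝒢 : Type*} [TopologicalSpace X] [TopologicalSpace 𝒢]
    [MeasurableSpace 𝒢] [BorelSpace 𝒢] (S : GroupoidStr X 𝒢) (lam : X → Measure 𝒢) : Prop where
  regular : ∀ x, (lam x).Regular
  support_eq : ∀ x, (lam x).support = {γ | S.r γ = x}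
  continuous_integral : ∀ f : 𝒢 → ℂ, Continuous f → HasCompactSupport f →
    Continuous (fun x => ∫ γ, f γ ∂(lam x))
  left_invariant : ∀ (γ : 𝒢) (f : 𝒢 → ℂ), Continuous f → HasCompactSupport f →
    ∫ η, (if h : S.s γ = S.r η then f (S.mul γ η h) else 0) ∂(lam (S.s γ))
      = ∫ η, f η ∂(lam (S.r γ))

/-! ## The space of closed subsets -/

/-- The space `𝒞(X)` of all closed subsets of `X`, the empty set included. -/
@[ext]
structure ClosedSubsets (X : Type*) [TopologicalSpace X] where
  carrier : Set X
  isClosed : IsClosed carrier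

namespace ClosedSubsets

variable {X : Type*} [TopologicalSpace X]

/-- The compact "hit-or-miss" topology on `𝒞(X)` (the Vietoris topology in the sense used for
locally compact spaces, also called the Fell topology): it is generated by the sets
`{A | A ∩ U ≠ ∅}` with `U` open and `{A | A ∩ K = ∅}` with `K` compact. For `X` locally compact,
second countable and Hausdorff it is compact and metrizable, and `A n → A` if and only if
`liminf A n = limsup A n = A`. -/
instance : TopologicalSpace (ClosedSubsets X) :=
  TopologicalSpace.generateFrom
    ({S | ∃ U : Set X, IsOpen U ∧ S = {A | (A.carrier ∩ U).Nonempty}} ∪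
      {S | ∃ K : Set X, IsCompact K ∧ S = {A | A.carrier ∩ K = ∅}})

/-- The right translate `A g = {a g | a ∈ A}`. -/
def translate {G : Type*} [TopologicalSpace G] [Group G] [IsTopologicalGroup G]
    (A : ClosedSubsets G) (g : G) : ClosedSubsets G :=
  ⟨(fun a => a * g) '' A.carrier, (Homeomorph.mulRight g).isClosedMap _ A.isClosed⟩

section translate

variable {G : Type*} [TopologicalSpace G] [Group G] [IsTopologicalGroup G]

theorem translate_one (A : ClosedSubsets G) : A.translate 1 = A :=
  ClosedSubsets.ext (by simp [translate])

theorem translate_mul (A : ClosedSubsets G) (g h : G) :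
    A.translate (g * h) = (A.translate g).translate h :=
  ClosedSubsets.ext (by simp only [translate, Set.image_image, mul_assoc])

theorem eq_translate_of_eq {A B : ClosedSubsets G} {a b : G}
    (h : A.translate a = B.translate b) : B = A.translate (a * b⁻¹) := by
  rw [translate_mul, h, ← translate_mul, mul_inv_cancel, translate_one]

end translate

end ClosedSubsets

section

variable {G : Type*} [TopologicalSpace G] [Group G] [IsTopologicalGroup G]

/-! ## Semigroups and isometric representations -/

/-- The standing assumptions on the semigroup `P ⊆ G` (a submonoid, so that it contains the
identity): `P` is closed, `G = P P⁻¹`, and the interior of `P` is dense in `P`. -/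
structure IsOreSemigroup (P : Submonoid G) : Prop where
  closed : IsClosed (P : Set G)
  ore : ∀ g : G, ∃ a b : P, g = a * (b : G)⁻¹
  dense_interior : (P : Set G) ⊆ closure (interior (P : Set G))

variable {P : Submonoid G} {H : Type*} [NormedAddCommGroup H] [InnerProductSpace ℂ H]
  [CompleteSpace H]

/-- Isometric representations of `P` on `H`; note the order reversal `V_a V_b = V_{ba}`. -/
structure IsIsometricRep (V : P → H →L[ℂ] H) : Prop where
  continuous : ∀ ξ : H, Continuous fun a => V a ξ
  continuous_adjoint : ∀ ξ : H, Continuous fun a => (V a).adjoint ξ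
  isometry : ∀ a, Isometry (V a)
  mul : ∀ a b, V a * V b = V (b * a)

/-- The range projections `V_a V_a^*` commute with each other. -/
def HasCommutingRangeProjections (V : P → H →L[ℂ] H) : Prop :=
  ∀ a b, Commute (V a * (V a).adjoint) (V b * (V b).adjoint)

open Classical in
/-- `W_g = V_b^* V_a` for `g = a b⁻¹` with `a, b ∈ P`. By `W_eq` this does not depend on the choice
of `a` and `b`. -/
def W (V : P → H →L[ℂ] H) (g : G) : H →L[ℂ] H :=
  if h : ∃ p : P × P, g = p.1 * (p.2 : G)⁻¹ then (V h.choose.2).adjoint * V h.choose.1 else 0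

/-- `E_g = W_g W_g^*`. -/
def E (V : P → H →L[ℂ] H) (g : G) : H →L[ℂ] H := W V g * (W V g).adjoint

theorem IsIsometricRep.adjoint_mul_self {V : P → H →L[ℂ] H} (hV : IsIsometricRep V) (a : P) :
    (V a).adjoint * V a = 1 :=
  (V a).norm_map_iff_adjoint_comp_self.mp
    (fun x => by simpa using (hV.isometry a).norm_map_of_map_zero (map_zero _) x)

theorem W_eq {V : P → H →L[ℂ] H} (hP : IsOreSemigroup P) (hV : IsIsometricRep V) (a b : P) :
    W V (a * (b : G)⁻¹) = (V b).adjoint * V a := by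
  have key : ∀ a b c d : P, (a : G) * (b : G)⁻¹ = c * (d : G)⁻¹ →
      (V b).adjoint * V a = (V d).adjoint * V c := by
    intro a b c d h
    obtain ⟨x, y, hxy⟩ := hP.ore ((a : G)⁻¹ * c)
    have h1 : a * x = c * y := by
      apply Subtype.ext
      have : (x : G) = (a : G)⁻¹ * c * y := by rw [hxy]; group
      push_cast
      rw [this]; group
    have h2 : b * x = d * y := by
      apply Subtype.ext
      have e1 : (x : G) = (a : G)⁻¹ * c * y := by rw [hxy]; group
      have e2 : (c : G) = a * (b : G)⁻¹ * d := by rw [h]; group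
      push_cast
      rw [e1, e2]; group
    have stretch : ∀ a b x : P, (V b).adjoint * V a = (V (b * x)).adjoint * V (a * x) := by
      intro a b x
      rw [← hV.mul x b, ← hV.mul x a, ← ContinuousLinearMap.star_eq_adjoint,
        ← ContinuousLinearMap.star_eq_adjoint, star_mul, ContinuousLinearMap.star_eq_adjoint (V x),
        mul_assoc, ← mul_assoc ((V x).adjoint), hV.adjoint_mul_self, one_mul]
    rw [stretch a b x, stretch c d y, h1, h2]
  have h : ∃ p : P × P, (a : G) * (b : G)⁻¹ = p.1 * (p.2 : G)⁻¹ := ⟨(a, b), rfl⟩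
  rw [W, dif_pos h]
  exact (key a b _ _ h.choose_spec).symm

theorem IsIsometricRep.norm_le_one {V : P → H →L[ℂ] H} (hV : IsIsometricRep V) (a : P) :
    ‖V a‖ ≤ 1 :=
  (V a).opNorm_le_bound zero_le_one fun x => by
    simpa using ((hV.isometry a).norm_map_of_map_zero (map_zero _) x).le

theorem norm_W_le {V : P → H →L[ℂ] H} (hP : IsOreSemigroup P) (hV : IsIsometricRep V) (g : G) :
    ‖W V g‖ ≤ 1 := by
  obtain ⟨a, b, rfl⟩ := hP.ore g
  rw [W_eq hP hV]
  refine (norm_mul_le _ _).trans ?_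
  rw [LinearIsometryEquiv.norm_map]
  exact mul_le_one₀ (hV.norm_le_one b) (norm_nonneg _) (hV.norm_le_one a)

theorem norm_E_apply_le {V : P → H →L[ℂ] H} (hP : IsOreSemigroup P) (hV : IsIsometricRep V)
    (g : G) (ξ : H) : ‖E V g ξ‖ ≤ ‖ξ‖ := by
  have h : ‖E V g‖ ≤ 1 := by
    refine (norm_mul_le _ _).trans ?_
    rw [LinearIsometryEquiv.norm_map]
    exact mul_le_one₀ (norm_W_le hP hV g) (norm_nonneg _) (norm_W_le hP hV g)
  simpa using (E V g).le_of_opNorm_le h ξ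

theorem exists_mem_interior (hP : IsOreSemigroup P) (g : G) :
    ∃ a b : P, (a : G) ∈ interior (P : Set G) ∧ g = a * (b : G)⁻¹ := by
  obtain ⟨c, hc⟩ : (interior (P : Set G)).Nonempty :=
    closure_nonempty_iff.mp ⟨1, hP.dense_interior P.one_mem⟩
  obtain ⟨a, b, rfl⟩ := hP.ore g
  refine ⟨a * ⟨c, interior_subset hc⟩, b * ⟨c, interior_subset hc⟩, ?_, by push_cast; group⟩
  rw [mem_interior]
  refine ⟨(fun x => (a : G) * x) '' interior (P : Set G), ?_,
    (Homeomorph.mulLeft (a : G)).isOpenMap _ isOpen_interior, ⟨c, hc, rfl⟩⟩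
  rintro _ ⟨x, hx, rfl⟩
  exact P.mul_mem a.2 (interior_subset hx)

theorem continuous_E_apply {V : P → H →L[ℂ] H} (hP : IsOreSemigroup P) (hV : IsIsometricRep V)
    (ξ : H) : Continuous fun g : G => E V g ξ := by
  rw [continuous_iff_continuousAt]
  intro g₀
  obtain ⟨a, b, ha, rfl⟩ := exists_mem_interior hP g₀
  set N : Set G := {g | g * b ∈ interior (P : Set G)} with hN
  have hNo : IsOpen N := isOpen_interior.preimage (continuous_mul_const (b : G))
  have hmem : (a : G) * (b : G)⁻¹ ∈ N := by simpa [hN] using ha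
  refine ContinuousOn.continuousAt (s := N) ?_ (hNo.mem_nhds hmem)
  rw [continuousOn_iff_continuous_domRestrict]
  let q : N → P := fun g => ⟨g.1 * b, interior_subset g.2⟩
  have hq : Continuous q := by
    apply Continuous.subtype_mk
    exact (continuous_mul_const (b : G)).comp continuous_subtype_val
  have hE : ∀ g : N, E V g.1 ξ
      = (V b).adjoint (V (q g) ((V (q g)).adjoint (V b ξ))) := by
    intro g
    have : (g : G) = (q g : G) * (b : G)⁻¹ := by simp [q]
    rw [E, this, W_eq hP hV, ← ContinuousLinearMap.star_eq_adjoint (_ * _), star_mul,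
      ContinuousLinearMap.star_eq_adjoint, ContinuousLinearMap.star_eq_adjoint,
      ContinuousLinearMap.adjoint_adjoint]
    rfl
  have : N.domRestrict (fun g : G => E V g ξ)
      = fun g : N => (V b).adjoint (V (q g) ((V (q g)).adjoint (V b ξ))) := funext hE
  rw [this]
  refine (V b).adjoint.continuous.comp ?_
  have h1 : Continuous fun g : N => (V (q g)).adjoint (V b ξ) :=
    (hV.continuous_adjoint (V b ξ)).comp hq
  rw [continuous_iff_continuousAt]
  intro g
  rw [ContinuousAt, tendsto_iff_norm_sub_tendsto_zero]
  have h2 : Filter.Tendsto (fun x : N => V (q x) ((V (q g)).adjoint (V b ξ))) (𝓝 g)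
      (𝓝 (V (q g) ((V (q g)).adjoint (V b ξ)))) :=
    ((hV.continuous _).comp hq).continuousAt
  have h3 := (tendsto_iff_norm_sub_tendsto_zero.mp h1.continuousAt).add
    (tendsto_iff_norm_sub_tendsto_zero.mp h2)
  rw [add_zero] at h3
  refine squeeze_zero (fun _ => norm_nonneg _) (fun x => ?_) h3
  have h4 : ‖V (q x) ((V (q x)).adjoint (V b ξ)) - V (q x) ((V (q g)).adjoint (V b ξ))‖
      = ‖(V (q x)).adjoint (V b ξ) - (V (q g)).adjoint (V b ξ)‖ := by
    rw [← map_sub]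
    exact (hV.isometry _).norm_map_of_map_zero (map_zero _) _
  rw [← h4]
  exact norm_sub_le_norm_sub_add_norm_sub _ _ _

variable [MeasurableSpace G]

open Classical in
/-- The operator `E_f = ∫ f(g) E_g dg`, an integral in the strong operator topology; by
`Eint_apply` it exists for every integrable `f`. -/
def Eint (μ : Measure G) (V : P → H →L[ℂ] H) (f : G → ℂ) : H →L[ℂ] H :=
  if h : ∃ T : H →L[ℂ] H, ∀ ξ, T ξ = ∫ g, f g • E V g ξ ∂μ then h.choose else 0

theorem integrable_smul_E [BorelSpace G] [SecondCountableTopology G] {μ : Measure G}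
    {V : P → H →L[ℂ] H} (hP : IsOreSemigroup P) (hV : IsIsometricRep V) {f : G → ℂ}
    (hf : Integrable f μ) (ξ : H) : Integrable (fun g => f g • E V g ξ) μ :=
  hf.smul_bdd ‖ξ‖ (continuous_E_apply hP hV ξ).aestronglyMeasurable
    (Filter.Eventually.of_forall fun g => norm_E_apply_le hP hV g ξ)

theorem Eint_apply [BorelSpace G] [SecondCountableTopology G] {μ : Measure G}
    {V : P → H →L[ℂ] H} (hP : IsOreSemigroup P) (hV : IsIsometricRep V) {f : G → ℂ}
    (hf : Integrable f μ) (ξ : H) : Eint μ V f ξ = ∫ g, f g • E V g ξ ∂μ := by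
  have hi := integrable_smul_E hP hV hf
  let L : H →ₗ[ℂ] H :=
    { toFun := fun ξ => ∫ g, f g • E V g ξ ∂μ
      map_add' := fun x y => by
        simp only [map_add, smul_add]
        exact integral_add (hi x) (hi y)
      map_smul' := fun c x => by
        simp only [map_smul, RingHom.id_apply, smul_comm _ c]
        exact integral_smul _ _ }
  have h : ∃ T : H →L[ℂ] H, ∀ ξ, T ξ = ∫ g, f g • E V g ξ ∂μ := by
    refine ⟨L.mkContinuous (∫ g, ‖f g‖ ∂μ) fun x => ?_, fun ξ => rfl⟩
    rw [← integral_mul_const]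
    refine norm_integral_le_of_norm_le (hf.norm.mul_const _)
      (Filter.Eventually.of_forall fun g => ?_)
    rw [norm_smul]
    exact mul_le_mul_of_nonneg_left (norm_E_apply_le hP hV g x) (norm_nonneg _)
  rw [Eint, dif_pos h]
  exact h.choose_spec ξ

/-- The `C^*`-algebra `𝒜` generated by the operators `E_f`, `f ∈ L¹(G)`. -/
def rangeAlgebra (μ : Measure G) (V : P → H →L[ℂ] H) : NonUnitalStarSubalgebra ℂ (H →L[ℂ] H) :=
  (NonUnitalStarAlgebra.adjoin ℂ
    {T : H →L[ℂ] H | ∃ f : G → ℂ, Integrable f μ ∧ T = Eint μ V f}).topologicalClosure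

theorem Eint_mem (μ : Measure G) (V : P → H →L[ℂ] H) {f : G → ℂ} (hf : Integrable f μ) :
    Eint μ V f ∈ rangeAlgebra μ V :=
  NonUnitalStarSubalgebra.le_topologicalClosure _
    (NonUnitalStarAlgebra.subset_adjoin ℂ _ ⟨f, hf, rfl⟩)

variable [BorelSpace G]

/-- The support `A_χ` of a character `χ` of `𝒜`: a point `g` is outside `A_χ` if and only if it has
an open neighbourhood `U` such that `χ(E_f) = 0` for all `f ∈ C_c(G)` with `supp f ⊆ U`. -/
def charSupport (μ : Measure G) [IsFiniteMeasureOnCompacts μ] (V : P → H →L[ℂ] H)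
    (χ : WeakDual.characterSpace ℂ (rangeAlgebra μ V)) : ClosedSubsets G :=
  ⟨{g | ∃ U : Set G, IsOpen U ∧ g ∈ U ∧
      ∀ (f : G → ℂ) (hf : Continuous f) (hc : HasCompactSupport f), tsupport f ⊆ U →
        χ ⟨Eint μ V f, Eint_mem μ V (hf.integrable_of_hasCompactSupport hc)⟩ = 0}ᶜ, by
    rw [isClosed_compl_iff, isOpen_iff_forall_mem_open]
    rintro g ⟨U, hU, hg, h⟩
    exact ⟨U, fun x hx => ⟨U, hU, hx, h⟩, hU, hg⟩⟩

/-- The spectrum `Ω` of `𝒜`, viewed through `χ ↦ A_χ` as a subset (and then a subspace) of the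
space of closed subsets of `G`. -/
def Omega (μ : Measure G) [IsFiniteMeasureOnCompacts μ] (V : P → H →L[ℂ] H) :
    Set (ClosedSubsets G) :=
  Set.range (charSupport μ V)

end

/-! ## The semidirect product groupoid -/

section

variable {G : Type*} [TopologicalSpace G] [Group G] [IsTopologicalGroup G]

/-- `(x, g)` is (the first two components of) an arrow of `X ⋊ P`: there is `y ∈ X` such that
`g = a b⁻¹` and `x a = y b` for some `a, b ∈ P`. Here `X` is a set of closed subsets of `G` on which
`P` acts by right translation. -/
def IsArrow (P : Submonoid G) {X : Set (ClosedSubsets G)} (x : X) (g : G) : Prop :=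
  ∃ (y : X) (a b : P), g = a * (b : G)⁻¹ ∧ x.1.translate a = y.1.translate b

/-- The arrows of `X ⋊ P`: the triples `(x, g, y)` with `x, y ∈ X` and `g = a b⁻¹`, `x a = y b`
for some `a, b ∈ P`. As `y` is determined by `(x, g)`, the arrows are regarded as pairs `(x, g)`. -/
@[ext]
structure Semidirect (P : Submonoid G) (X : Set (ClosedSubsets G)) where
  fst : X
  snd : G
  isArrow : IsArrow P fst snd

variable {P : Submonoid G} {X : Set (ClosedSubsets G)}

namespace Semidirect

/-- The topology of `X ⋊ P` is the subspace topology of `X × G`. -/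
instance : TopologicalSpace (Semidirect P X) :=
  TopologicalSpace.induced (fun γ => (γ.fst, γ.snd)) inferInstance

instance : MeasurableSpace (Semidirect P X) := borel _

instance : BorelSpace (Semidirect P X) := ⟨rfl⟩

theorem source_mem (γ : Semidirect P X) : γ.fst.1.translate γ.snd ∈ X := by
  obtain ⟨y, a, b, hg, h⟩ := γ.isArrow
  rw [hg, ← ClosedSubsets.eq_translate_of_eq h]
  exact y.2

/-- The third component `y` of the arrow `(x, g, y)`; it is the translate `x g`. -/
def source (γ : Semidirect P X) : X := ⟨γ.fst.1.translate γ.snd, γ.source_mem⟩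

/-- `source γ` is the only `y` that makes `(x, g, y)` an arrow. -/
theorem eq_source (γ : Semidirect P X) (y : X) (a b : P) (hg : γ.snd = a * (b : G)⁻¹)
    (h : γ.fst.1.translate a = y.1.translate b) : y = γ.source := by
  apply Subtype.ext
  rw [ClosedSubsets.eq_translate_of_eq h, ← hg]
  rfl

/-- Assuming `G = P P⁻¹`, a pair `(x, g)` with `x g ∈ X` is an arrow. -/
theorem isArrow_of_translate_mem (hP : IsOreSemigroup P) (x : X) (g : G)
    (h : x.1.translate g ∈ X) : IsArrow P x g := by
  obtain ⟨a, b, hg⟩ := hP.ore g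
  refine ⟨⟨_, h⟩, a, b, hg, ?_⟩
  rw [← ClosedSubsets.translate_mul, hg, inv_mul_cancel_right]

theorem translate_translate_inv (A : ClosedSubsets G) (g : G) :
    (A.translate g).translate g⁻¹ = A := by
  rw [← ClosedSubsets.translate_mul, mul_inv_cancel, ClosedSubsets.translate_one]

theorem translate_mul_of_source_eq (γ η : Semidirect P X) (h : γ.source = η.fst) :
    γ.fst.1.translate (γ.snd * η.snd) = η.source.1 := by
  rw [ClosedSubsets.translate_mul, show γ.fst.1.translate γ.snd = η.fst.1 from
    congrArg Subtype.val h]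
  rfl

/-- The groupoid `X ⋊ P`, with `(x, g, y)(y, h, z) = (x, g h, z)` and
`(x, g, y)⁻¹ = (y, g⁻¹, x)`. -/
def groupoid (hP : IsOreSemigroup P) (X : Set (ClosedSubsets G)) :
    GroupoidStr X (Semidirect P X) where
  r γ := γ.fst
  s γ := γ.source
  unit x := ⟨x, 1, isArrow_of_translate_mem hP x 1
    ((ClosedSubsets.translate_one x.1).symm ▸ x.2)⟩
  inv γ := ⟨γ.source, γ.snd⁻¹, isArrow_of_translate_mem hP _ _
    ((translate_translate_inv γ.fst.1 γ.snd).symm ▸ γ.fst.2)⟩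
  mul γ η h := ⟨γ.fst, γ.snd * η.snd, isArrow_of_translate_mem hP _ _
    ((translate_mul_of_source_eq γ η h).symm ▸ η.source.2)⟩
  r_unit _ := rfl
  s_unit _ := Subtype.ext (ClosedSubsets.translate_one _)
  r_inv _ := rfl
  s_inv _ := Subtype.ext (translate_translate_inv _ _)
  r_mul _ _ _ := rfl
  s_mul γ η h := Subtype.ext (translate_mul_of_source_eq γ η h)
  mul_assoc _ _ _ _ _ := Semidirect.ext rfl (mul_assoc _ _ _)
  unit_mul _ := Semidirect.ext rfl (one_mul _)
  mul_unit _ := Semidirect.ext rfl (mul_one _)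
  mul_inv _ := Semidirect.ext rfl (mul_inv_cancel _)
  inv_mul _ := Semidirect.ext rfl (inv_mul_cancel _)

/-- `Q_x = {g ∈ G | (x, g) ∈ X ⋊ P}`. -/
def Q (P : Submonoid G) (x : X) : Set G := {g | IsArrow P x g}

/-- The measure `1_{Q_x}(g) dg` on `X ⋊ P`: the restriction of `μ` to `Q_x`, carried to the fibre
over `x` by `g ↦ (x, g)`. -/
def fibreMeasure [MeasurableSpace G] (P : Submonoid G) (μ : Measure G) (x : X) :
    Measure (Semidirect P X) :=
  (μ.comap ((↑) : Q P x → G)).map (fun g => ⟨x, g.1, g.2⟩)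

end Semidirect

end

end IsometricRep

end

set_option linter.unusedSectionVars false

noncomputable section

namespace IsometricRep

/-! ### The commuting projections `E_g` and the partial isometries `W_g` -/

section Operators

variable {G : Type*} [TopologicalSpace G] [Group G] [IsTopologicalGroup G]
  {P : Submonoid G} {H : Type*} [NormedAddCommGroup H] [InnerProductSpace ℂ H]
  [CompleteSpace H] {V : P → H →L[ℂ] H}

/-! The `E_g` are commuting projections that decrease along `P`: `E_{pg} ≤ E_g` for `p ∈ P`, and
`E_g = 1` on `P⁻¹`. Hence, if `f` lives on `P h` and `k` on `P⁻¹ h`, each projection entering `E_k`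
dominates each one entering `E_f`, and `E_f E_k = (∫ k) E_f`. For a multiplicative functional `φ`
with `φ(E_f) ≠ 0` this forces `φ(E_k) = ∫ k` (`apply_rangeElt_eq_integral`). So the support `A` of
`φ` satisfies `P⁻¹ A ⊆ A`, it contains `P⁻¹` as soon as `φ ≠ 0`, and, since both `φ(E_f) ≠ 0` and
`φ(E_k) ≠ ∫ k` are open conditions on `φ`, it depends continuously on `φ`. The multiplicative
functionals, zero included, form a weak-* compact set. Zero is the only one with empty support, so
`Ω` is an open subset of a compact set of closed sets.

Assertion 1. Every member of `Ω` contains `1`, so `Ag ∈ Ω` gives `g⁻¹ ∈ A`. Conversely, covariance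
`W_g E_h W_g^* = E_{hg} E_g` turns a functional with support `A` into one with support `A g⁻¹`,
provided `g ∈ Int(P)⁻¹ A` (`exists_translate_functional`). The remaining points are reached by a
limit `s → 1` in `Int(P)`, using compactness (`translate_mem_Omega_iff`).

Assertion 2. By assertion 1 the arrows are the pairs `(A, g)` with `g⁻¹ ∈ A`, a closed subset of `Ω
× G`, and `Q_A = A⁻¹`. Left invariance is that of `dg`, because `Q_{Ag} = g⁻¹ Q_A`. For continuity
of the integrals, membership of `g⁻¹` in `A` is locally constant in `A` except when `g⁻¹` lies in `A
\ Int(P)⁻¹ A`. That set is null (`measure_isClosed_diff_eq_zero`), so dominated convergence applies.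
-/

theorem exists_common_denominator (hP : IsOreSemigroup P) (g h : G) :
    ∃ a b c : P, g = a * (b : G)⁻¹ ∧ h = c * (b : G)⁻¹ := by
  obtain ⟨a, b, rfl⟩ := hP.ore g
  obtain ⟨c, d, rfl⟩ := hP.ore h
  -- The Ore condition for `b⁻¹ d` yields a common right multiple `b x = d y` of the two
  -- denominators.
  obtain ⟨x, y, hxy⟩ := hP.ore ((b : G)⁻¹ * d)
  have e : (b : G) * x = d * y := by
    have : (x : G) = (b : G)⁻¹ * d * y := by rw [hxy]; group
    rw [this]; group
  refine ⟨a * x, b * x, c * y, by push_cast; group, ?_⟩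
  push_cast
  rw [e]; group

theorem W_adjoint (hP : IsOreSemigroup P) (hV : IsIsometricRep V) (g : G) :
    (W V g).adjoint = W V g⁻¹ := by
  obtain ⟨a, b, rfl⟩ := hP.ore g
  rw [mul_inv_rev, inv_inv, W_eq hP hV, W_eq hP hV, ← ContinuousLinearMap.star_eq_adjoint, star_mul,
    ContinuousLinearMap.star_eq_adjoint, ContinuousLinearMap.star_eq_adjoint,
    ContinuousLinearMap.adjoint_adjoint]

theorem E_eq (hP : IsOreSemigroup P) (hV : IsIsometricRep V) (a b : P) :
    E V (a * (b : G)⁻¹) = (V b).adjoint * (V a * (V a).adjoint) * V b := by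
  rw [E, W_adjoint hP hV, mul_inv_rev, inv_inv, W_eq hP hV, W_eq hP hV]
  simp only [mul_assoc]

theorem IsIsometricRep.mul_adjoint_mul_self (hV : IsIsometricRep V) (a : P) :
    V a * (V a).adjoint * V a = V a := by
  rw [mul_assoc, hV.adjoint_mul_self, mul_one]

theorem IsIsometricRep.adjoint_mul_mul_adjoint (hV : IsIsometricRep V) (a : P) :
    (V a).adjoint * (V a * (V a).adjoint) = (V a).adjoint := by
  rw [← mul_assoc, hV.adjoint_mul_self, one_mul]

theorem IsIsometricRep.isIdempotentElem_range (hV : IsIsometricRep V) (a : P) :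
    V a * (V a).adjoint * (V a * (V a).adjoint) = V a * (V a).adjoint := by
  rw [← mul_assoc, hV.mul_adjoint_mul_self]

theorem IsIsometricRep.map_one (hV : IsIsometricRep V) : V 1 = 1 := by
  have h : V 1 * V 1 = V 1 := by rw [hV.mul, mul_one]
  calc V 1 = (V 1).adjoint * V 1 * V 1 := by rw [hV.adjoint_mul_self, one_mul]
    _ = 1 := by rw [mul_assoc, h, hV.adjoint_mul_self]

/-- The projection `V_b V_b^*` that appears in the middle commutes past the range projection of
`V_a` and is absorbed by `V_b^*`. Relations between the `E_g` thus reduce to relations between range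
projections. -/
theorem E_mul_E (hP : IsOreSemigroup P) (hV : IsIsometricRep V)
    (hcomm : HasCommutingRangeProjections V) (a b c : P) :
    E V (a * (b : G)⁻¹) * E V (c * (b : G)⁻¹) =
      (V b).adjoint * (V a * (V a).adjoint * (V c * (V c).adjoint)) * V b := by
  rw [E_eq hP hV, E_eq hP hV]
  set A := V a * (V a).adjoint with hA
  set C := V c * (V c).adjoint with hC
  calc (V b).adjoint * A * V b * ((V b).adjoint * C * V b)
      = (V b).adjoint * (A * (V b * (V b).adjoint)) * C * V b := by simp only [mul_assoc]
    _ = (V b).adjoint * (V b * (V b).adjoint * A) * C * V b := by rw [hA, (hcomm a b).eq]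
    _ = (V b).adjoint * (V b * (V b).adjoint) * A * C * V b := by simp only [mul_assoc]
    _ = _ := by rw [hV.adjoint_mul_mul_adjoint]; simp only [mul_assoc]

theorem E_commute (hP : IsOreSemigroup P) (hV : IsIsometricRep V)
    (hcomm : HasCommutingRangeProjections V) (g h : G) : Commute (E V g) (E V h) := by
  obtain ⟨a, b, c, rfl, rfl⟩ := exists_common_denominator hP g h
  rw [Commute, SemiconjBy, E_mul_E hP hV hcomm, E_mul_E hP hV hcomm, (hcomm a c).eq]

theorem E_mul_self (hP : IsOreSemigroup P) (hV : IsIsometricRep V)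
    (hcomm : HasCommutingRangeProjections V) (g : G) : E V g * E V g = E V g := by
  obtain ⟨a, b, rfl⟩ := hP.ore g
  rw [E_mul_E hP hV hcomm, hV.isIdempotentElem_range, ← E_eq hP hV]

/-- `E` is decreasing: `E_{pg} ≤ E_g` for `p ∈ P`. -/
theorem E_mul_left_mul_E (hP : IsOreSemigroup P) (hV : IsIsometricRep V)
    (hcomm : HasCommutingRangeProjections V) {p : G} (hp : p ∈ P) (g : G) :
    E V (p * g) * E V g = E V (p * g) := by
  obtain ⟨a, b, rfl⟩ := hP.ore g
  have e : p * (a * (b : G)⁻¹) = ((⟨p, hp⟩ * a : P) : G) * (b : G)⁻¹ := by push_cast; group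
  -- `V_{pa} = V_a V_p`, so the range of `V_{pa}` lies in that of `V_a`.
  have hA : V (⟨p, hp⟩ * a) * (V (⟨p, hp⟩ * a)).adjoint * (V a * (V a).adjoint)
      = V (⟨p, hp⟩ * a) * (V (⟨p, hp⟩ * a)).adjoint := by
    rw [(hcomm _ _).eq, ← mul_assoc, ← hV.mul a, ← mul_assoc (V a * _), hV.mul_adjoint_mul_self]
  rw [e, E_mul_E hP hV hcomm, hA, ← E_eq hP hV]

theorem E_inv_of_mem (hP : IsOreSemigroup P) (hV : IsIsometricRep V) {p : G} (hp : p ∈ P) :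
    E V p⁻¹ = 1 := by
  have e : p⁻¹ = ((1 : P) : G) * ((⟨p, hp⟩ : P) : G)⁻¹ := by simp
  have h1 : V 1 * (V 1).adjoint = 1 := by
    have := hV.adjoint_mul_self 1
    rw [hV.map_one, mul_one] at this
    rw [hV.map_one, one_mul, this]
  rw [e, E_eq hP hV, h1, mul_one, hV.adjoint_mul_self]

theorem W_mul_E_mul_adjoint (hP : IsOreSemigroup P) (hV : IsIsometricRep V)
    (hcomm : HasCommutingRangeProjections V) (g h : G) :
    W V g * E V h * (W V g).adjoint = E V (h * g) * E V g := by
  -- The common denominator is taken for `g⁻¹` and `h`, so that `h g = (c a⁻¹)(a b⁻¹)` telescopes.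
  obtain ⟨b, a, c, hb, rfl⟩ := exists_common_denominator hP g⁻¹ h
  obtain rfl : g = a * (b : G)⁻¹ := by rw [← inv_inv g, hb]; group
  have e : (c : G) * (a : G)⁻¹ * (a * (b : G)⁻¹) = c * (b : G)⁻¹ := by group
  rw [e, E_mul_E hP hV hcomm, W_adjoint hP hV, mul_inv_rev, inv_inv, W_eq hP hV, W_eq hP hV,
    E_eq hP hV]
  set A := V a * (V a).adjoint with hA
  set C := V c * (V c).adjoint with hC
  calc (V b).adjoint * V a * ((V a).adjoint * C * V a) * ((V a).adjoint * V b)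
      = (V b).adjoint * (A * C * A) * V b := by simp only [hA, mul_assoc]
    _ = (V b).adjoint * (C * A) * V b := by
        rw [(hcomm a c).eq, mul_assoc C, hV.isIdempotentElem_range]

/-- `W_g` is a partial isometry with initial projection `E_{g⁻¹} = W_g^* W_g`. -/
theorem W_mul_E_inv (hP : IsOreSemigroup P) (hV : IsIsometricRep V)
    (hcomm : HasCommutingRangeProjections V) (g : G) : W V g * E V g⁻¹ = W V g := by
  obtain ⟨a, b, rfl⟩ := hP.ore g
  rw [mul_inv_rev, inv_inv, W_eq hP hV, E_eq hP hV]
  calc (V b).adjoint * V a * ((V a).adjoint * (V b * (V b).adjoint) * V a)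
      = (V b).adjoint * ((V a * (V a).adjoint) * (V b * (V b).adjoint)) * V a := by
        simp only [mul_assoc]
    _ = (V b).adjoint * V a := by
        rw [(hcomm a b).eq, ← mul_assoc, hV.adjoint_mul_mul_adjoint, mul_assoc,
          hV.mul_adjoint_mul_self]

theorem adjoint_mul_W (hP : IsOreSemigroup P) (hV : IsIsometricRep V) (g : G) :
    (W V g).adjoint * W V g = E V g⁻¹ := by
  rw [E, W_adjoint hP hV, W_adjoint hP hV, inv_inv]

theorem E_adjoint (V : P → H →L[ℂ] H) (g : G) : star (E V g) = E V g := by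
  rw [E, ← ContinuousLinearMap.star_eq_adjoint, star_mul, star_star]

end Operators

/-! ### The algebra `𝒜`: absorption and conjugation by `W_g` -/

section RangeAlgebra

variable {G : Type*} [TopologicalSpace G] [Group G] [IsTopologicalGroup G]
  [SecondCountableTopology G] [MeasurableSpace G] [BorelSpace G] {μ : Measure G}
  {P : Submonoid G} {H : Type*} [NormedAddCommGroup H] [InnerProductSpace ℂ H]
  [CompleteSpace H] {V : P → H →L[ℂ] H}

/-- `E_f` as an element of `𝒜`. -/
def rangeElt (V : P → H →L[ℂ] H) {f : G → ℂ} (hf : Integrable f μ) : rangeAlgebra μ V :=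
  ⟨Eint μ V f, Eint_mem μ V hf⟩

theorem apply_Eint (hP : IsOreSemigroup P) (hV : IsIsometricRep V) {f : G → ℂ}
    (hf : Integrable f μ) (T : H →L[ℂ] H) (ξ : H) :
    T (Eint μ V f ξ) = ∫ g, f g • T (E V g ξ) ∂μ := by
  rw [Eint_apply hP hV hf, ← T.integral_comp_comm (integrable_smul_E hP hV hf ξ)]
  simp only [map_smul]

theorem commute_Eint (hP : IsOreSemigroup P) (hV : IsIsometricRep V) {f : G → ℂ}
    (hf : Integrable f μ) {T : H →L[ℂ] H} (hT : ∀ g, Commute T (E V g)) :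
    Commute T (Eint μ V f) := by
  ext ξ
  change T (Eint μ V f ξ) = Eint μ V f (T ξ)
  rw [apply_Eint hP hV hf, Eint_apply hP hV hf]
  congr 1 with g
  congr 1
  exact congr($((hT g).eq) ξ)

theorem commute_E_of_mem (hP : IsOreSemigroup P) (hV : IsIsometricRep V)
    (hcomm : HasCommutingRangeProjections V) {T : H →L[ℂ] H} (hT : T ∈ rangeAlgebra μ V) (g : G) :
    Commute T (E V g) := by
  have hc : IsClosed {T : H →L[ℂ] H | T * E V g = E V g * T} :=
    isClosed_eq (continuous_mul_const _) (continuous_const_mul _)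
  refine closure_minimal (fun S hS => ?_) hc hT
  induction hS using NonUnitalStarAlgebra.adjoin_induction with
  | mem x hx =>
    obtain ⟨f, hf, rfl⟩ := hx
    exact (commute_Eint hP hV hf fun h => E_commute hP hV hcomm g h).symm.eq
  | add x y _ _ hx hy => exact Commute.add_left hx hy
  | zero => exact Commute.zero_left _
  | mul x y _ _ hx hy => exact Commute.mul_left hx hy
  | smul r x _ hx => exact Commute.smul_left hx r
  | star x _ hx =>
    have h := Commute.star_star (x := x) (y := E V g) hx
    rwa [E_adjoint] at h

theorem E_mul_Eint (hP : IsOreSemigroup P) (hV : IsIsometricRep V)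
    (hcomm : HasCommutingRangeProjections V) {f : G → ℂ} (hf : Integrable f μ) {g : G}
    (hfs : ∀ h, f h ≠ 0 → h * g⁻¹ ∈ P) : E V g * Eint μ V f = Eint μ V f := by
  ext ξ
  change E V g (Eint μ V f ξ) = _
  rw [apply_Eint hP hV hf, Eint_apply hP hV hf]
  congr 1 with h
  by_cases hh : f h = 0
  · simp [hh]
  · have e := E_mul_left_mul_E hP hV hcomm (hfs h hh) g
    rw [inv_mul_cancel_right, (E_commute hP hV hcomm h g).eq] at e
    congr 1
    exact congr($e ξ)

/-- If `f(x) ≠ 0` and `k(g) ≠ 0`, then `x g⁻¹ = (x h⁻¹)(h g⁻¹) ∈ P`, so `E_x ≤ E_g`. Each `E_g` in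
the integral for `E_k` therefore acts as the identity on `E_f`. -/
theorem Eint_mul_Eint (hP : IsOreSemigroup P) (hV : IsIsometricRep V)
    (hcomm : HasCommutingRangeProjections V) {f k : G → ℂ} (hf : Integrable f μ)
    (hk : Integrable k μ) {h : G} (hfs : ∀ g, f g ≠ 0 → g * h⁻¹ ∈ P)
    (hks : ∀ g, k g ≠ 0 → h * g⁻¹ ∈ P) :
    Eint μ V f * Eint μ V k = (∫ g, k g ∂μ) • Eint μ V f := by
  ext ξ
  change Eint μ V f (Eint μ V k ξ) = (∫ g, k g ∂μ) • Eint μ V f ξ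
  rw [apply_Eint hP hV hk, ← integral_smul_const]
  congr 1 with g
  by_cases hg : k g = 0
  · simp [hg]
  · congr 1
    have e : E V g * Eint μ V f = Eint μ V f := by
      refine E_mul_Eint hP hV hcomm hf fun x hx => ?_
      have := P.mul_mem (hfs x hx) (hks g hg)
      rwa [mul_assoc, inv_mul_cancel_left] at this
    have e' := (commute_E_of_mem hP hV hcomm (Eint_mem μ V hf) g).eq
    rw [e] at e'
    exact congr($e' ξ)

theorem rangeElt_mul_rangeElt (hP : IsOreSemigroup P) (hV : IsIsometricRep V)
    (hcomm : HasCommutingRangeProjections V) {f k : G → ℂ} (hf : Integrable f μ)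
    (hk : Integrable k μ) {h : G} (hfs : ∀ g, f g ≠ 0 → g * h⁻¹ ∈ P)
    (hks : ∀ g, k g ≠ 0 → h * g⁻¹ ∈ P) :
    rangeElt V hf * rangeElt V hk = (∫ g, k g ∂μ) • rangeElt V hf :=
  Subtype.ext (Eint_mul_Eint hP hV hcomm hf hk hfs hks)

variable [LocallyCompactSpace G] [μ.IsHaarMeasure]

/-- The constant is a value of the modular function; only its being nonzero matters below. -/
theorem exists_map_mul_right_eq_smul (μ : Measure G) [μ.IsHaarMeasure] (g : G) :
    ∃ c : NNReal, c ≠ 0 ∧ μ.map (· * g) = c • μ := by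
  refine ⟨_, ?_, Measure.isMulLeftInvariant_eq_smul (μ.map (· * g)) μ⟩
  exact (Measure.haarScalarFactor_pos_of_isHaarMeasure _ _).ne'

theorem integrable_comp_mul_right {f : G → ℂ} (hf : Integrable f μ) (g : G) :
    Integrable (fun x => f (x * g⁻¹)) μ := by
  obtain ⟨c, hc, h⟩ := exists_map_mul_right_eq_smul μ g
  have h1 : Integrable (fun x => f (x * g⁻¹)) (μ.map (· * g)) := by
    refine (Homeomorph.mulRight g).measurableEmbedding.integrable_map_iff.mpr ?_
    simpa [Function.comp_def] using hf
  rw [h] at h1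
  have h2 := h1.smul_measure_nnreal (c := c⁻¹)
  rwa [smul_smul, inv_mul_cancel₀ hc, one_smul] at h2

theorem exists_W_mul_Eint_mul_adjoint (hP : IsOreSemigroup P) (hV : IsIsometricRep V)
    (hcomm : HasCommutingRangeProjections V) (g : G) :
    ∃ c : NNReal, c ≠ 0 ∧ ∀ f : G → ℂ, Integrable f μ →
      W V g * Eint μ V f * (W V g).adjoint
        = (c : ℂ) • Eint μ V (fun x => f (x * g⁻¹)) * E V g := by
  obtain ⟨c, hc, h⟩ := exists_map_mul_right_eq_smul μ g
  refine ⟨c, hc, fun f hf => ?_⟩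
  ext ξ
  change W V g (Eint μ V f ((W V g).adjoint ξ))
    = (c : ℂ) • Eint μ V (fun x => f (x * g⁻¹)) (E V g ξ)
  rw [apply_Eint hP hV hf, Eint_apply hP hV (integrable_comp_mul_right hf g)]
  have h1 := (Homeomorph.mulRight g).measurableEmbedding.integral_map (μ := μ)
    (fun x => f (x * g⁻¹) • E V x (E V g ξ))
  have h2 : (c : ℂ) • ∫ x, f (x * g⁻¹) • E V x (E V g ξ) ∂μ
      = ∫ x, f (x * g⁻¹) • E V x (E V g ξ) ∂(μ.map (· * g)) := by
    rw [h, integral_smul_nnreal_measure]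
    rfl
  rw [h2]
  refine Eq.trans ?_ h1.symm
  congr 1 with x
  simp only [Homeomorph.coe_mulRight, mul_inv_cancel_right]
  congr 1
  exact congr($(W_mul_E_mul_adjoint hP hV hcomm g x) ξ)

/-- The conjugate of `T` is only shown to lie in `𝒜 E_g`. Restricting to the algebraic span avoids
having to control `S` in a limit; the closure is handled in `W_mul_mul_adjoint_mul_mem`, where a
factor `R = E_g R` absorbs `E_g`. -/
theorem exists_mem_W_mul_mul_adjoint (hP : IsOreSemigroup P) (hV : IsIsometricRep V)
    (hcomm : HasCommutingRangeProjections V) (g : G) {T : H →L[ℂ] H}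
    (hT : T ∈ NonUnitalStarAlgebra.adjoin ℂ
      {T : H →L[ℂ] H | ∃ f : G → ℂ, Integrable f μ ∧ T = Eint μ V f}) :
    ∃ S ∈ rangeAlgebra μ V, W V g * T * (W V g).adjoint = S * E V g := by
  induction hT using NonUnitalStarAlgebra.adjoin_induction with
  | mem x hx =>
    obtain ⟨f, hf, rfl⟩ := hx
    obtain ⟨c, -, hc⟩ := exists_W_mul_Eint_mul_adjoint (μ := μ) hP hV hcomm g
    exact ⟨_, SMulMemClass.smul_mem _ (Eint_mem μ V (integrable_comp_mul_right hf g)), hc f hf⟩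
  | add x y _ _ hx hy =>
    obtain ⟨S, hS, hS'⟩ := hx
    obtain ⟨R, hR, hR'⟩ := hy
    exact ⟨S + R, add_mem hS hR, by rw [mul_add, add_mul, hS', hR', add_mul]⟩
  | zero => exact ⟨0, zero_mem _, by simp⟩
  | mul x y hx₀ hy₀ hx hy =>
    obtain ⟨S, hS, hS'⟩ := hx
    obtain ⟨R, hR, hR'⟩ := hy
    have hy₁ := (commute_E_of_mem hP hV hcomm
      (NonUnitalStarSubalgebra.le_topologicalClosure _ hy₀ : y ∈ rangeAlgebra μ V) g⁻¹).eq
    refine ⟨S * R, mul_mem hS hR, ?_⟩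
    -- Conjugation by `W_g` is multiplicative here because the initial projection `E_{g⁻¹}` commutes
    -- with `y`.
    calc W V g * (x * y) * (W V g).adjoint
        = W V g * x * y * (W V g * E V g⁻¹).adjoint := by
          rw [W_mul_E_inv hP hV hcomm]; simp only [mul_assoc]
      _ = W V g * x * (y * E V g⁻¹) * (W V g).adjoint := by
          rw [← ContinuousLinearMap.star_eq_adjoint (_ * _), star_mul, E_adjoint,
            ContinuousLinearMap.star_eq_adjoint]
          simp only [mul_assoc]
      _ = (W V g * x * (W V g).adjoint) * (W V g * y * (W V g).adjoint) := by
          rw [hy₁, ← adjoint_mul_W hP hV]; simp only [mul_assoc]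
      _ = S * (E V g * R) * E V g := by rw [hS', hR']; simp only [mul_assoc]
      _ = S * R * E V g := by
          rw [← (commute_E_of_mem hP hV hcomm hR g).eq, mul_assoc, mul_assoc R,
            E_mul_self hP hV hcomm, mul_assoc]
  | smul r x _ hx =>
    obtain ⟨S, hS, hS'⟩ := hx
    exact ⟨r • S, SMulMemClass.smul_mem r hS, by
      rw [mul_smul_comm, smul_mul_assoc, hS', smul_mul_assoc]⟩
  | star x _ hx =>
    obtain ⟨S, hS, hS'⟩ := hx
    refine ⟨star S, star_mem hS, ?_⟩
    have h := congr(star $hS')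
    simp only [← ContinuousLinearMap.star_eq_adjoint, star_mul, star_star, E_adjoint,
      ← mul_assoc] at h
    rw [← ContinuousLinearMap.star_eq_adjoint]
    rw [h, (commute_E_of_mem hP hV hcomm (star_mem hS) g).eq]

theorem W_mul_mul_adjoint_mul_mem (hP : IsOreSemigroup P) (hV : IsIsometricRep V)
    (hcomm : HasCommutingRangeProjections V) {g : G} {T R : H →L[ℂ] H}
    (hT : T ∈ rangeAlgebra μ V) (hR : R ∈ rangeAlgebra μ V) (hgR : E V g * R = R) :
    W V g * T * (W V g).adjoint * R ∈ rangeAlgebra μ V := by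
  have hc : IsClosed {T : H →L[ℂ] H | W V g * T * (W V g).adjoint * R ∈ rangeAlgebra μ V} := by
    refine (NonUnitalStarSubalgebra.isClosed_topologicalClosure _).preimage ?_
    fun_prop
  refine closure_minimal (fun S hS => ?_) hc hT
  obtain ⟨S', hS', e⟩ := exists_mem_W_mul_mul_adjoint hP hV hcomm g hS
  change W V g * S * (W V g).adjoint * R ∈ rangeAlgebra μ V
  rw [e, mul_assoc, hgR]
  exact mul_mem hS' hR

end RangeAlgebra

/-! ### Small displacements by interior points of `P`, and test functions -/

section Semigroup

variable {G : Type*} [TopologicalSpace G] [Group G] [IsTopologicalGroup G] {P : Submonoid G}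

theorem one_mem_closure_interior (hP : IsOreSemigroup P) :
    (1 : G) ∈ closure (interior (P : Set G)) := hP.dense_interior P.one_mem

theorem exists_mem_interior_inv_mul_mem (hP : IsOreSemigroup P) {U : Set G} (hU : IsOpen U) {g : G}
    (hg : g ∈ U) : ∃ s ∈ interior (P : Set G), s⁻¹ * g ∈ U := by
  have hc : Continuous fun s : G => s⁻¹ * g := by fun_prop
  obtain ⟨s, hs, hs'⟩ := mem_closure_iff.mp (one_mem_closure_interior hP) _ (hU.preimage hc)
    (by simpa using hg)
  exact ⟨s, hs', hs⟩

theorem exists_mem_interior_mul_mem (hP : IsOreSemigroup P) {U : Set G} (hU : IsOpen U) {g : G}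
    (hg : g ∈ U) : ∃ s ∈ interior (P : Set G), g * s ∈ U := by
  have hc : Continuous fun s : G => g * s := by fun_prop
  obtain ⟨s, hs, hs'⟩ := mem_closure_iff.mp (one_mem_closure_interior hP) _ (hU.preimage hc)
    (by simpa using hg)
  exact ⟨s, hs', hs⟩

end Semigroup

section Bump

variable {G : Type*} [TopologicalSpace G] [LocallyCompactSpace G] [T2Space G] [MeasurableSpace G]
  [BorelSpace G] (μ : Measure G) [IsFiniteMeasureOnCompacts μ] [μ.IsOpenPosMeasure]

theorem exists_bump_integral_ne_zero {U : Set G} (hU : IsOpen U) (hne : U.Nonempty) :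
    ∃ f : G → ℂ, Continuous f ∧ HasCompactSupport f ∧ tsupport f ⊆ U ∧ ∫ x, f x ∂μ ≠ 0 := by
  obtain ⟨g, hg⟩ := hne
  obtain ⟨f, h1, h2, h3, h4⟩ := exists_continuousMap_one_of_isCompact_subset_isOpen
    (isCompact_singleton (x := g)) hU (Set.singleton_subset_iff.mpr hg)
  have hs : tsupport (fun x => (f x : ℂ)) ⊆ tsupport f :=
    closure_mono fun x hx hx' => hx (by simp [hx'])
  refine ⟨fun x => f x, Complex.continuous_ofReal.comp f.continuous,
    h2.of_isClosed_subset isClosed_closure hs, hs.trans h3, ?_⟩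
  rw [integral_complex_ofReal, Complex.ofReal_ne_zero]
  refine (f.continuous.integral_pos_of_hasCompactSupport_nonneg_nonzero h2
    (fun x => (h4 x).1) (x := g) ?_).ne'
  rw [h1 rfl]
  exact one_ne_zero

end Bump

/-! ### Supports of multiplicative functionals on `𝒜` -/

section Support

variable {G : Type*} [TopologicalSpace G] [Group G] [IsTopologicalGroup G]
  [SecondCountableTopology G] [MeasurableSpace G] [BorelSpace G]
  {μ : Measure G} [μ.IsHaarMeasure]
  {P : Submonoid G} {H : Type*} [NormedAddCommGroup H] [InnerProductSpace ℂ H]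
  [CompleteSpace H] {V : P → H →L[ℂ] H}

/-- The support of a continuous functional on `𝒜`. -/
def functionalSupport (φ : WeakDual ℂ (rangeAlgebra μ V)) : ClosedSubsets G :=
  ⟨{g | ∃ U : Set G, IsOpen U ∧ g ∈ U ∧
      ∀ (f : G → ℂ) (hf : Continuous f) (hc : HasCompactSupport f), tsupport f ⊆ U →
        φ (rangeElt V (hf.integrable_of_hasCompactSupport hc : Integrable f μ)) = 0}ᶜ, by
    rw [isClosed_compl_iff, isOpen_iff_forall_mem_open]
    rintro g ⟨U, hU, hg, h⟩
    exact ⟨U, fun x hx => ⟨U, hU, hx, h⟩, hU, hg⟩⟩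

theorem notMem_functionalSupport {φ : WeakDual ℂ (rangeAlgebra μ V)} {g : G} :
    g ∉ (functionalSupport φ).carrier ↔ ∃ U : Set G, IsOpen U ∧ g ∈ U ∧
      ∀ (f : G → ℂ) (hf : Continuous f) (hc : HasCompactSupport f), tsupport f ⊆ U →
        φ (rangeElt V (hf.integrable_of_hasCompactSupport hc : Integrable f μ)) = 0 :=
  Set.notMem_compl_iff

theorem exists_apply_ne_zero {φ : WeakDual ℂ (rangeAlgebra μ V)} {g : G}
    (hg : g ∈ (functionalSupport φ).carrier) {U : Set G} (hU : IsOpen U) (hgU : g ∈ U) :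
    ∃ (f : G → ℂ) (hf : Integrable f μ), tsupport f ⊆ U ∧ φ (rangeElt V hf) ≠ 0 := by
  by_contra! h
  exact notMem_functionalSupport.mpr ⟨U, hU, hgU, fun f hf hc hfU => h f _ hfU⟩ hg

theorem functionalSupport_zero :
    (functionalSupport (0 : WeakDual ℂ (rangeAlgebra μ V))).carrier = ∅ :=
  Set.eq_empty_of_forall_notMem fun _ =>
    notMem_functionalSupport.mpr ⟨Set.univ, isOpen_univ, trivial, fun _ _ _ _ => rfl⟩

/-- The set of multiplicative functionals on `𝒜`: the characters and zero. -/
def multiplicativeFunctionals (μ : Measure G) (V : P → H →L[ℂ] H) :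
    Set (WeakDual ℂ (rangeAlgebra μ V)) :=
  {φ | ∀ x y, φ (x * y) = φ x * φ y}

theorem functionalSupport_mem_Omega {φ : WeakDual ℂ (rangeAlgebra μ V)}
    (hφ : φ ∈ multiplicativeFunctionals μ V)
    (hne : (functionalSupport φ).carrier.Nonempty) : functionalSupport φ ∈ Omega μ V := by
  refine ⟨⟨φ, ?_, hφ⟩, rfl⟩
  rintro rfl
  rw [functionalSupport_zero] at hne
  exact Set.not_nonempty_empty hne

theorem exists_of_mem_Omega {A : ClosedSubsets G} (hA : A ∈ Omega μ V) :
    ∃ φ ∈ multiplicativeFunctionals μ V, φ ≠ 0 ∧ functionalSupport φ = A := by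
  obtain ⟨χ, rfl⟩ := hA
  exact ⟨χ, χ.2.2, χ.2.1, rfl⟩

/-- Adjoining zero to the characters makes the set weak-* closed. From `|φ(x)|² = |φ(x²)| ≤ ‖φ‖
‖x‖²` follows `‖φ‖² ≤ ‖φ‖`, so it lies in the unit ball. -/
theorem isCompact_multiplicativeFunctionals : IsCompact (multiplicativeFunctionals μ V) := by
  refine (WeakDual.isCompact_closedBall (0 : StrongDual ℂ (rangeAlgebra μ V)) 1).of_isClosed_subset
    ?_ fun φ hφ => ?_
  · have := WeakDual.CharacterSpace.union_zero_isClosed ℂ (rangeAlgebra μ V)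
    rwa [WeakDual.CharacterSpace.union_zero] at this
  · rw [Set.mem_preimage, mem_closedBall_zero_iff]
    set ψ := WeakDual.toStrongDual φ with hψ
    have h1 : ‖ψ‖ ≤ Real.sqrt ‖ψ‖ := by
      refine ψ.opNorm_le_bound (Real.sqrt_nonneg _) fun x => ?_
      have h2 : ‖ψ x‖ ^ 2 ≤ ‖ψ‖ * ‖x‖ ^ 2 := by
        calc ‖ψ x‖ ^ 2 = ‖ψ (x * x)‖ := by
              rw [sq, ← norm_mul]; exact congrArg norm (hφ x x).symm
          _ ≤ ‖ψ‖ * ‖x * x‖ := ψ.le_opNorm _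
          _ ≤ ‖ψ‖ * ‖x‖ ^ 2 := by
              rw [sq]; exact mul_le_mul_of_nonneg_left (norm_mul_le _ _) (norm_nonneg _)
      rw [← Real.sqrt_sq (norm_nonneg x), ← Real.sqrt_mul (norm_nonneg _)]
      exact Real.le_sqrt_of_sq_le h2
    nlinarith [Real.sq_sqrt (norm_nonneg ψ), norm_nonneg ψ, Real.sqrt_nonneg ‖ψ‖]

/-- Apply `φ` to `E_f E_k = (∫ k) E_f` and cancel `φ(E_f)`. -/
theorem apply_rangeElt_eq_integral (hP : IsOreSemigroup P) (hV : IsIsometricRep V)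
    (hcomm : HasCommutingRangeProjections V) {φ : WeakDual ℂ (rangeAlgebra μ V)}
    (hφ : φ ∈ multiplicativeFunctionals μ V) {f k : G → ℂ} {hf : Integrable f μ}
    (hk : Integrable k μ) {h : G} (hfs : ∀ g, f g ≠ 0 → g * h⁻¹ ∈ P)
    (hks : ∀ g, k g ≠ 0 → h * g⁻¹ ∈ P) (hne : φ (rangeElt V hf) ≠ 0) :
    φ (rangeElt V hk) = ∫ g, k g ∂μ := by
  have h1 := hφ (rangeElt V hf) (rangeElt V hk)
  rw [rangeElt_mul_rangeElt hP hV hcomm hf hk hfs hks, map_smul, smul_eq_mul, mul_comm] at h1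
  exact (mul_left_cancel₀ hne h1).symm

variable [LocallyCompactSpace G] [T2Space G]

theorem exists_supported_right_of_mem {φ : WeakDual ℂ (rangeAlgebra μ V)} {g h : G}
    (hg : g ∈ (functionalSupport φ).carrier) (hgh : g * h⁻¹ ∈ interior (P : Set G)) :
    ∃ (f : G → ℂ) (hf : Integrable f μ), (∀ x, f x ≠ 0 → x * h⁻¹ ∈ P) ∧
      φ (rangeElt V hf) ≠ 0 := by
  obtain ⟨f, hf, hfU, hne⟩ := exists_apply_ne_zero hg
    (isOpen_interior.preimage (continuous_mul_const h⁻¹)) hgh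
  exact ⟨f, hf, fun x hx => interior_subset (hfU (subset_closure hx)), hne⟩

/-- Near `g ∈ Int(P)⁻¹ h` there are bumps `k` supported in `P⁻¹ h` with `∫ k ≠ 0`, and `φ(E_k) = ∫
k` for them. -/
theorem mem_functionalSupport_of_apply_ne_zero (hP : IsOreSemigroup P) (hV : IsIsometricRep V)
    (hcomm : HasCommutingRangeProjections V) {φ : WeakDual ℂ (rangeAlgebra μ V)}
    (hφ : φ ∈ multiplicativeFunctionals μ V) {f : G → ℂ} {hf : Integrable f μ} {g h : G}
    (hfs : ∀ x, f x ≠ 0 → x * h⁻¹ ∈ P) (hne : φ (rangeElt V hf) ≠ 0)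
    (hgh : h * g⁻¹ ∈ interior (P : Set G)) : g ∈ (functionalSupport φ).carrier := by
  by_contra hg
  obtain ⟨U, hU, hgU, hv⟩ := notMem_functionalSupport.mp hg
  have hN : IsOpen {x : G | h * x⁻¹ ∈ interior (P : Set G)} :=
    isOpen_interior.preimage (by fun_prop)
  obtain ⟨k, hk, hkc, hks, hki⟩ := exists_bump_integral_ne_zero μ (hU.inter hN) ⟨g, hgU, hgh⟩
  apply hki
  rw [← hv k hk hkc (hks.trans Set.inter_subset_left)]
  exact (apply_rangeElt_eq_integral hP hV hcomm hφ _ hfs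
    (fun x hx => interior_subset (hks (subset_closure hx)).2) hne).symm

theorem inv_mul_mem_of_forall_interior (hP : IsOreSemigroup P) {A : Set G} (hA : IsClosed A) {a : G}
    (h : ∀ s ∈ interior (P : Set G), ∀ t ∈ interior (P : Set G), t⁻¹ * (s⁻¹ * a) ∈ A) {p : G}
    (hp : p ∈ P) : p⁻¹ * a ∈ A := by
  have hc : ∀ b : G, Continuous fun s : G => s⁻¹ * b := fun b => by fun_prop
  have h1 : ∀ s ∈ interior (P : Set G), s⁻¹ * a ∈ A := fun s hs => by
    -- Two successive limits: here `t → 1` with `s` fixed, and below `s → p`.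
    have : closure (interior (P : Set G)) ⊆ (fun t => t⁻¹ * (s⁻¹ * a)) ⁻¹' A :=
      closure_minimal (h s hs) (hA.preimage (hc _))
    simpa using this (one_mem_closure_interior hP)
  exact closure_minimal (s := interior (P : Set G)) (t := (fun s => s⁻¹ * a) ⁻¹' A) h1
    (hA.preimage (hc a)) (hP.dense_interior hp)

/-- The support of a multiplicative functional is invariant under left multiplication by `P⁻¹`. -/
theorem inv_mul_mem_functionalSupport (hP : IsOreSemigroup P) (hV : IsIsometricRep V)
    (hcomm : HasCommutingRangeProjections V) {φ : WeakDual ℂ (rangeAlgebra μ V)}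
    (hφ : φ ∈ multiplicativeFunctionals μ V) {p a : G} (hp : p ∈ P)
    (ha : a ∈ (functionalSupport φ).carrier) : p⁻¹ * a ∈ (functionalSupport φ).carrier := by
  refine inv_mul_mem_of_forall_interior hP (functionalSupport φ).isClosed (fun s hs t ht => ?_) hp
  -- The intermediate point `h = s⁻¹ a` separates the two points: `a ∈ Int(P) h` and `t⁻¹ s⁻¹ a ∈
  -- Int(P)⁻¹ h`.
  obtain ⟨f, hf, hfs, hne⟩ := exists_supported_right_of_mem (P := P) (h := s⁻¹ * a) ha
    (by simpa using hs)
  exact mem_functionalSupport_of_apply_ne_zero hP hV hcomm hφ hfs hne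
    (by rwa [mul_inv_rev, mul_inv_cancel_left, inv_inv])

/-- Since `E_g = 1` on `P⁻¹`, a bump `k` supported in `Int(P)⁻¹` has `E_k = (∫ k) 1`. If `φ` killed
it, `φ` would vanish on all of `𝒜`. -/
theorem inv_mem_functionalSupport (hP : IsOreSemigroup P) (hV : IsIsometricRep V)
    {φ : WeakDual ℂ (rangeAlgebra μ V)}
    (hφ : φ ∈ multiplicativeFunctionals μ V) (hφ0 : φ ≠ 0) {p : G} (hp : p ∈ P) :
    p⁻¹ ∈ (functionalSupport φ).carrier := by
  have hsub : interior (P : Set G) ⊆ (fun s => s⁻¹) ⁻¹' (functionalSupport φ).carrier := by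
    intro s hs
    by_contra hg
    obtain ⟨U, hU, hgU, hv⟩ := notMem_functionalSupport.mp hg
    obtain ⟨k, hk, hkc, hks, hki⟩ := exists_bump_integral_ne_zero μ
      (hU.inter isOpen_interior.inv) ⟨s⁻¹, hgU, by simpa using hs⟩
    have hk' : Integrable k μ := hk.integrable_of_hasCompactSupport hkc
    have h0 : φ (rangeElt V hk') = 0 := hv k hk hkc (hks.trans Set.inter_subset_left)
    have h1 : Eint μ V k = (∫ g, k g ∂μ) • (1 : H →L[ℂ] H) := by
      ext ξ
      change _ = (∫ g, k g ∂μ) • ξ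
      rw [Eint_apply hP hV hk', ← integral_smul_const]
      congr 1 with g
      by_cases hg : k g = 0
      · simp [hg]
      · have := E_inv_of_mem hP hV (V := V)
          (interior_subset (Set.mem_inv.mp (hks (subset_closure hg)).2))
        rw [inv_inv] at this
        rw [this]; rfl
    refine hφ0 (ContinuousLinearMap.ext fun x => ?_)
    have h2 : rangeElt V hk' * x = (∫ g, k g ∂μ) • x := Subtype.ext <| by
      change Eint μ V k * x.1 = (∫ g, k g ∂μ) • x.1
      rw [h1, smul_mul_assoc, one_mul]
    have h3 := hφ (rangeElt V hk') x
    rw [h0, zero_mul, h2, map_smul, smul_eq_mul] at h3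
    exact (mul_eq_zero.mp h3).resolve_left hki
  exact closure_minimal hsub ((functionalSupport φ).isClosed.preimage continuous_inv)
    (hP.dense_interior hp)

/-- The functional `T ↦ φ(W_g T W_g^* S) / φ(S)`. -/
theorem exists_translate_functional (hP : IsOreSemigroup P) (hV : IsIsometricRep V)
    (hcomm : HasCommutingRangeProjections V) {φ : WeakDual ℂ (rangeAlgebra μ V)}
    (hφ : φ ∈ multiplicativeFunctionals μ V) {f : G → ℂ} {hf : Integrable f μ} {g : G}
    (hfs : ∀ x, f x ≠ 0 → x * g⁻¹ ∈ P) (hne : φ (rangeElt V hf) ≠ 0) :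
    ∃ ψ ∈ multiplicativeFunctionals μ V, ∃ c : ℂ, c ≠ 0 ∧ ∀ (k : G → ℂ) (hk : Integrable k μ),
      ψ (rangeElt V hk) = c * φ (rangeElt V (integrable_comp_mul_right hk g)) := by
  set R := Eint μ V f with hR
  have hRm : R ∈ rangeAlgebra μ V := Eint_mem μ V hf
  have hgR : E V g * R = R := E_mul_Eint hP hV hcomm hf hfs
  have hmem := fun T : rangeAlgebra μ V =>
    W_mul_mul_adjoint_mul_mem (μ := μ) hP hV hcomm T.2 hRm hgR
  let L : rangeAlgebra μ V →L[ℂ] rangeAlgebra μ V :=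
    { toFun := fun T => ⟨W V g * T.1 * (W V g).adjoint * R, hmem T⟩
      map_add' := fun S T => Subtype.ext <| by
        change W V g * (S.1 + T.1) * (W V g).adjoint * R =
          W V g * S.1 * (W V g).adjoint * R + W V g * T.1 * (W V g).adjoint * R
        simp only [mul_add, add_mul]
      map_smul' := fun c T => Subtype.ext <| by
        change W V g * (c • T.1) * (W V g).adjoint * R = c • (W V g * T.1 * (W V g).adjoint * R)
        simp only [mul_smul_comm, smul_mul_assoc]
      cont := by
        apply Continuous.subtype_mk
        fun_prop }
  have hL : ∀ T, (L T).1 = W V g * T.1 * (W V g).adjoint * R := fun _ => rfl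
  set r := φ (rangeElt V hf) with hr
  let ψ : WeakDual ℂ (rangeAlgebra μ V) := r⁻¹ • (φ : rangeAlgebra μ V →L[ℂ] ℂ).comp L
  have hψ : ∀ T, ψ T = r⁻¹ * φ (L T) := fun _ => rfl
  -- Conjugation by `W_g` is multiplicative on `𝒜`, and `R = E_f` commutes with `L T`. One extra
  -- factor `R` balances the two on the right; applying `φ` and dividing by `φ(R)²` makes `ψ`
  -- multiplicative.
  have hLmul : ∀ S T, L (S * T) * rangeElt V hf = L S * L T := fun S T => Subtype.ext <| by
    change W V g * (S.1 * T.1) * (W V g).adjoint * R * R = _ * R * (_ * R)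
    have hc1 := (commute_E_of_mem hP hV hcomm T.2 g⁻¹).eq
    have hc2 : R * (L T).1 = (L T).1 * R :=
      (commute_Eint hP hV hf (commute_E_of_mem hP hV hcomm (L T).2)).eq.symm
    rw [hL] at hc2
    have h1 : W V g * S.1 * (W V g).adjoint * (W V g * T.1 * (W V g).adjoint) =
        W V g * (S.1 * T.1) * (W V g).adjoint := by
      calc _ = W V g * S.1 * (((W V g).adjoint * W V g) * T.1) * (W V g).adjoint := by
            simp only [mul_assoc]
        _ = W V g * S.1 * T.1 * (W V g * E V g⁻¹).adjoint := by
            rw [adjoint_mul_W hP hV, ← hc1, ← ContinuousLinearMap.star_eq_adjoint (_ * _),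
              star_mul, E_adjoint, ContinuousLinearMap.star_eq_adjoint]
            simp only [mul_assoc]
        _ = _ := by rw [W_mul_E_inv hP hV hcomm]; simp only [mul_assoc]
    have h2 : W V g * S.1 * (W V g).adjoint * (W V g * T.1 * (W V g).adjoint) * R * R =
        W V g * S.1 * (W V g).adjoint * (W V g * T.1 * (W V g).adjoint * R * R) := by
      simp only [mul_assoc]
    rw [← h1, h2, ← hc2]
    simp only [mul_assoc]
  refine ⟨ψ, fun S T => ?_, ?_⟩
  · have h1 := congr(φ $(hLmul S T))
    rw [hφ, hφ, ← hr] at h1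
    rw [hψ, hψ, hψ]
    field_simp
    linear_combination h1
  · obtain ⟨c, hc, h⟩ := exists_W_mul_Eint_mul_adjoint (μ := μ) hP hV hcomm g
    refine ⟨c, by exact_mod_cast hc, fun k hk => ?_⟩
    have h1 : L (rangeElt V hk)
        = (c : ℂ) • (rangeElt V (integrable_comp_mul_right hk g) * rangeElt V hf) :=
      Subtype.ext <| by
        change W V g * Eint μ V k * (W V g).adjoint * R
          = (c : ℂ) • (Eint μ V (fun x => k (x * g⁻¹)) * R)
        rw [h k hk, mul_assoc, hgR, smul_mul_assoc]
    rw [hψ, h1, map_smul, hφ, ← hr, smul_eq_mul]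
    field_simp

theorem tsupport_comp_mul_right_subset {k : G → ℂ} {g : G} {U : Set G}
    (h : tsupport k ⊆ (fun x => x * g) ⁻¹' U) : tsupport (fun x => k (x * g⁻¹)) ⊆ U := by
  intro x hx
  have h1 : tsupport (fun x => k (x * g⁻¹)) ⊆ (fun x => x * g⁻¹) ⁻¹' tsupport k :=
    tsupport_comp_subset_preimage k (continuous_mul_const g⁻¹)
  simpa using h (h1 hx)

theorem functionalSupport_translate {φ ψ : WeakDual ℂ (rangeAlgebra μ V)} {g : G} {c : ℂ}
    (hc : c ≠ 0) (h : ∀ (k : G → ℂ) (hk : Integrable k μ),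
      ψ (rangeElt V hk) = c * φ (rangeElt V (integrable_comp_mul_right hk g))) :
    functionalSupport ψ = (functionalSupport φ).translate g⁻¹ := by
  have key : ∀ x, x ∈ (functionalSupport ψ).carrier ↔ x * g ∈ (functionalSupport φ).carrier := by
    intro x
    rw [← not_iff_not, notMem_functionalSupport, notMem_functionalSupport]
    constructor
    · rintro ⟨U, hU, hx, hv⟩
      refine ⟨(fun y => y * g⁻¹) ⁻¹' U, hU.preimage (continuous_mul_const _), by simpa using hx,
        fun f hf hfc hfU => ?_⟩
      have h1 : tsupport (fun y => f (y * g⁻¹⁻¹)) ⊆ U := tsupport_comp_mul_right_subset hfU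
      simp only [inv_inv] at h1
      have h2 := hv (fun y => f (y * g)) (hf.comp (continuous_mul_const g))
        (hfc.comp_homeomorph (Homeomorph.mulRight g)) h1
      rw [h] at h2
      have h3 := (mul_eq_zero.mp h2).resolve_left hc
      simpa only [inv_mul_cancel_right] using h3
    · rintro ⟨U, hU, hx, hv⟩
      refine ⟨(fun y => y * g) ⁻¹' U, hU.preimage (continuous_mul_const _), hx,
        fun f hf hfc hfU => ?_⟩
      rw [h, hv (fun y => f (y * g⁻¹)) (hf.comp (continuous_mul_const g⁻¹))
        (hfc.comp_homeomorph (Homeomorph.mulRight g⁻¹)) (tsupport_comp_mul_right_subset hfU),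
        mul_zero]
  ext x
  rw [key]
  simp only [ClosedSubsets.translate, Set.image_mul_right, inv_inv, Set.mem_preimage]

/-- `Ag⁻¹ ∈ Ω` if `g` lies in `Int(P)⁻¹ A`. -/
theorem translate_inv_mem_Omega_of_interior (hP : IsOreSemigroup P) (hV : IsIsometricRep V)
    (hcomm : HasCommutingRangeProjections V) {A : ClosedSubsets G} (hA : A ∈ Omega μ V) {g a : G}
    (ha : a ∈ A.carrier) (hg : a * g⁻¹ ∈ interior (P : Set G)) :
    A.translate g⁻¹ ∈ Omega μ V := by
  obtain ⟨φ, hφ, -, rfl⟩ := exists_of_mem_Omega hA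
  obtain ⟨f, hf, hfs, hne⟩ := exists_supported_right_of_mem (P := P) ha hg
  obtain ⟨ψ, hψ, c, hc, h⟩ := exists_translate_functional hP hV hcomm hφ hfs hne
  rw [← functionalSupport_translate hc h]
  -- That `ψ ≠ 0` is read off its support, which contains `a g⁻¹`.
  refine functionalSupport_mem_Omega hψ ?_
  rw [functionalSupport_translate hc h]
  exact ⟨a * g⁻¹, a, ha, rfl⟩

/-- Hitting `U` is witnessed by the open condition `φ(E_f) ≠ 0`, with `f` supported just above a
point `h` of `U`. Missing a neighbourhood of `g` is witnessed by the open condition `φ(E_k) ≠ ∫ k`,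
with `k` supported just below a point `h = s⁻¹ g`: any support point in `Int(P) h` would force
equality. Compactness of `K` makes this uniform. The zero functional is included. -/
theorem continuousOn_functionalSupport (hP : IsOreSemigroup P) (hV : IsIsometricRep V)
    (hcomm : HasCommutingRangeProjections V) :
    ContinuousOn functionalSupport (multiplicativeFunctionals μ V) := by
  rw [continuousOn_iff_continuous_domRestrict]
  have hev : ∀ T : rangeAlgebra μ V,
      Continuous fun φ : multiplicativeFunctionals μ V => φ.1 T := fun T =>
    (WeakDual.eval_continuous T).comp continuous_subtype_val
  refine continuous_generateFrom_iff.mpr ?_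
  rintro S (⟨U, hU, rfl⟩ | ⟨K, hK, rfl⟩)
  · rw [isOpen_iff_mem_nhds]
    rintro ⟨φ, hφ⟩ ⟨g, hg, hgU⟩
    obtain ⟨s, hs, hsU⟩ := exists_mem_interior_inv_mul_mem hP hU hgU
    obtain ⟨t, ht, htU⟩ := exists_mem_interior_inv_mul_mem hP hU hsU
    obtain ⟨f, hf, hfs, hne⟩ := exists_supported_right_of_mem (P := P) (h := s⁻¹ * g) hg
      (by simpa using hs)
    filter_upwards [(hev (rangeElt V hf)).continuousAt.eventually_ne hne] with φ' hφ'
    exact ⟨_, mem_functionalSupport_of_apply_ne_zero hP hV hcomm φ'.2 hfs hφ'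
      (by rwa [mul_inv_rev, mul_inv_cancel_left, inv_inv]), htU⟩
  · rw [isOpen_iff_mem_nhds]
    rintro ⟨φ, hφ⟩ hdisj
    change ∀ᶠ φ' in 𝓝 (⟨φ, hφ⟩ : multiplicativeFunctionals μ V),
      (functionalSupport φ'.1).carrier ∩ K = ∅
    have hloc : ∀ g ∈ K, ∃ N ∈ 𝓝[K] g, ∀ᶠ φ' in 𝓝 (⟨φ, hφ⟩ : multiplicativeFunctionals μ V),
        (functionalSupport φ'.1).carrier ∩ N = ∅ := by
      intro g hg
      have hgn : g ∉ (functionalSupport φ).carrier := fun h =>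
        Set.eq_empty_iff_forall_notMem.mp hdisj g ⟨h, hg⟩
      obtain ⟨U, hU, hgU, hv⟩ := notMem_functionalSupport.mp hgn
      obtain ⟨s, hs, hsU⟩ := exists_mem_interior_inv_mul_mem hP hU hgU
      obtain ⟨t, ht, htU⟩ := exists_mem_interior_inv_mul_mem hP hU hsU
      have hN : IsOpen {x : G | s⁻¹ * g * x⁻¹ ∈ interior (P : Set G)} :=
        isOpen_interior.preimage (by fun_prop)
      obtain ⟨k, hk, hkc, hks, hki⟩ := exists_bump_integral_ne_zero μ (hU.inter hN)
        ⟨t⁻¹ * (s⁻¹ * g), htU, by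
          rwa [Set.mem_ofPred_eq, mul_inv_rev, mul_inv_cancel_left, inv_inv]⟩
      have hk' : Integrable k μ := hk.integrable_of_hasCompactSupport hkc
      refine ⟨{x | x * (s⁻¹ * g)⁻¹ ∈ interior (P : Set G)}, mem_nhdsWithin_of_mem_nhds
        ((isOpen_interior.preimage (continuous_mul_const _)).mem_nhds (by simpa using hs)), ?_⟩
      have h0 : φ (rangeElt V hk') ≠ ∫ g, k g ∂μ := by
        rw [hv k hk hkc (hks.trans Set.inter_subset_left)]
        exact hki.symm
      filter_upwards [(hev (rangeElt V hk')).continuousAt.eventually_ne h0] with φ' hφ'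
      refine Set.eq_empty_of_forall_notMem fun x ⟨hx, hxN⟩ => hφ' ?_
      obtain ⟨f, hf, hfs, hne⟩ := exists_supported_right_of_mem (P := P) hx hxN
      exact apply_rangeElt_eq_integral hP hV hcomm φ'.2 hk' hfs
        (fun x hx => interior_subset (hks (subset_closure hx)).2) hne
    refine hK.induction_on (by simp) (fun s t hst ht => ?_) (fun s t hs ht => ?_) hloc
    · filter_upwards [ht] with φ' h
      exact Set.subset_eq_empty (Set.inter_subset_inter_right _ hst) h
    · filter_upwards [hs, ht] with φ' h1 h2
      rw [Set.inter_union_distrib_left, h1, h2, Set.union_empty]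

end Support

/-! ### The space of closed subsets: separation, countability, translation -/

namespace ClosedSubsets

section Topology

variable {X : Type*} [TopologicalSpace X]

theorem isOpen_hit {U : Set X} (hU : IsOpen U) :
    IsOpen {A : ClosedSubsets X | (A.carrier ∩ U).Nonempty} :=
  TopologicalSpace.isOpen_generateFrom_of_mem (Or.inl ⟨U, hU, rfl⟩)

theorem isOpen_miss {K : Set X} (hK : IsCompact K) :
    IsOpen {A : ClosedSubsets X | A.carrier ∩ K = ∅} :=
  TopologicalSpace.isOpen_generateFrom_of_mem (Or.inr ⟨K, hK, rfl⟩)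

variable [LocallyCompactSpace X]

theorem exists_separation_of_mem_of_notMem {A B : ClosedSubsets X} {x : X} (hA : x ∈ A.carrier)
    (hB : x ∉ B.carrier) : ∃ u v : Set (ClosedSubsets X), IsOpen u ∧ IsOpen v ∧ A ∈ u ∧ B ∈ v ∧
      Disjoint u v := by
  obtain ⟨K, hK, hxK, hKB⟩ := exists_compact_subset B.isClosed.isOpen_compl hB
  refine ⟨_, _, isOpen_hit isOpen_interior, isOpen_miss hK, ⟨x, hA, hxK⟩,
    Set.eq_empty_of_forall_notMem fun y hy => hKB hy.2 hy.1, Set.disjoint_left.mpr ?_⟩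
  rintro C ⟨y, hy, hyK⟩ hC
  exact Set.eq_empty_iff_forall_notMem.mp hC y ⟨hy, interior_subset hyK⟩

instance : T2Space (ClosedSubsets X) := by
  refine ⟨fun A B hne => ?_⟩
  by_cases h : A.carrier ⊆ B.carrier
  · have h' : ¬ B.carrier ⊆ A.carrier := fun h' =>
      hne (ClosedSubsets.ext (Set.Subset.antisymm h h'))
    obtain ⟨x, hB, hA⟩ := Set.not_subset.mp h'
    obtain ⟨u, v, hu, hv, hBu, hAv, hd⟩ := exists_separation_of_mem_of_notMem hB hA
    exact ⟨v, u, hv, hu, hAv, hBu, hd.symm⟩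
  · obtain ⟨x, hA, hB⟩ := Set.not_subset.mp h
    exact exists_separation_of_mem_of_notMem hA hB

variable [T2Space X]

theorem exists_finite_basis_cover {B : Set (Set X)} (hB : TopologicalSpace.IsTopologicalBasis B)
    {K W : Set X} (hK : IsCompact K) (hW : IsOpen W) (hKW : K ⊆ W) :
    ∃ t : Set (Set X), t.Finite ∧ t ⊆ B ∧ IsCompact (⋃ U ∈ t, closure U) ∧
      K ⊆ ⋃ U ∈ t, closure U ∧ (⋃ U ∈ t, closure U) ⊆ W := by
  let S : Set (Set X) := {U | U ∈ B ∧ IsCompact (closure U) ∧ closure U ⊆ W}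
  have hS : K ⊆ ⋃ U ∈ S, U := by
    intro x hx
    obtain ⟨L, hL, hxL, hLW⟩ := exists_compact_subset hW (hKW hx)
    obtain ⟨U, hU, hxU, hUL⟩ := hB.exists_subset_of_mem_open hxL isOpen_interior
    have hcl : closure U ⊆ L := closure_minimal (hUL.trans interior_subset) hL.isClosed
    exact Set.mem_biUnion (⟨hU, hL.of_isClosed_subset isClosed_closure hcl, hcl.trans hLW⟩ : U ∈ S)
      hxU
  obtain ⟨t, htS, htf, htK⟩ :=
    hK.elim_finite_subcover_image (fun U hU => hB.isOpen hU.1) hS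
  refine ⟨t, htf, fun U hU => (htS hU).1, htf.isCompact_biUnion fun U hU => (htS hU).2.1,
    htK.trans (Set.iUnion₂_mono fun U _ => subset_closure),
    Set.iUnion₂_subset fun U hU => (htS hU).2.2⟩

/-- Between a compact set and an open neighbourhood one can fit a finite union of compact closures
of basic sets, so countably many miss-conditions suffice. This serves dominated convergence over `Ω`
and regularity of the fibre measures. -/
instance [SecondCountableTopology X] : SecondCountableTopology (ClosedSubsets X) := by
  set B := TopologicalSpace.countableBasis X
  have hB : TopologicalSpace.IsTopologicalBasis B := TopologicalSpace.isBasis_countableBasis X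
  let hit : Set X → Set (ClosedSubsets X) := fun U => {A | (A.carrier ∩ U).Nonempty}
  let miss : Set (Set X) → Set (ClosedSubsets X) := fun t =>
    {A | A.carrier ∩ ⋃ U ∈ t, closure U = ∅}
  let T : Set (Set (Set X)) := {t | (t.Finite ∧ t ⊆ B) ∧ IsCompact (⋃ U ∈ t, closure U)}
  have hT : T.Countable := (Set.countable_ofPred_finite_subset
    (TopologicalSpace.countable_countableBasis X)).mono fun t ht => ht.1
  refine ⟨hit '' B ∪ miss '' T, ((TopologicalSpace.countable_countableBasis X).image _).union
    (hT.image _), le_antisymm (le_generateFrom ?_) (le_generateFrom ?_)⟩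
  · rintro _ (⟨U, hU, rfl⟩ | ⟨t, ht, rfl⟩)
    · exact isOpen_hit (hB.isOpen hU)
    · exact isOpen_miss ht.2
  · let _ : TopologicalSpace (ClosedSubsets X) :=
      TopologicalSpace.generateFrom (hit '' B ∪ miss '' T)
    rintro _ (⟨U, hU, rfl⟩ | ⟨K, hK, rfl⟩)
    · rw [isOpen_iff_mem_nhds]
      rintro A ⟨x, hx, hxU⟩
      obtain ⟨V, hV, hxV, hVU⟩ := hB.exists_subset_of_mem_open hxU hU
      have ho : IsOpen (hit V) :=
        TopologicalSpace.isOpen_generateFrom_of_mem (Or.inl ⟨V, hV, rfl⟩)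
      exact Filter.mem_of_superset (ho.mem_nhds ⟨x, hx, hxV⟩)
        fun C hC => hC.mono (Set.inter_subset_inter_right _ hVU)
    · rw [isOpen_iff_mem_nhds]
      intro A hA
      obtain ⟨t, htf, htB, htc, hKt, htA⟩ := exists_finite_basis_cover hB hK
        A.isClosed.isOpen_compl (fun x hx hxA => Set.eq_empty_iff_forall_notMem.mp hA x ⟨hxA, hx⟩)
      have ho : IsOpen (miss t) :=
        TopologicalSpace.isOpen_generateFrom_of_mem (Or.inr ⟨t, ⟨⟨htf, htB⟩, htc⟩, rfl⟩)
      refine Filter.mem_of_superset (ho.mem_nhds (Set.eq_empty_of_forall_notMem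
        fun x hx => htA hx.2 hx.1)) fun C hC => ?_
      exact Set.subset_eq_empty (Set.inter_subset_inter_right _ hKt) hC

theorem eventually_notMem {A : ClosedSubsets X} {x : X} (hx : x ∉ A.carrier) :
    ∀ᶠ p : ClosedSubsets X × X in 𝓝 (A, x), p.2 ∉ p.1.carrier := by
  obtain ⟨K, hK, hxK, hKA⟩ := exists_compact_subset A.isClosed.isOpen_compl hx
  have h1 : ∀ᶠ C in 𝓝 A, C.carrier ∩ K = ∅ := (isOpen_miss hK).mem_nhds
    (Set.eq_empty_of_forall_notMem fun y hy => hKA hy.2 hy.1)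
  have h2 : ∀ᶠ y in 𝓝 x, y ∈ K := mem_interior_iff_mem_nhds.mp hxK
  rw [nhds_prod_eq]
  filter_upwards [h1.prod_mk h2] with p hp hpC
  exact Set.eq_empty_iff_forall_notMem.mp hp.1 p.2 ⟨hpC, hp.2⟩

end Topology

section Translate

variable {G : Type*} [TopologicalSpace G] [Group G] [IsTopologicalGroup G]

theorem mem_translate {A : ClosedSubsets G} {g x : G} :
    x ∈ (A.translate g).carrier ↔ x * g⁻¹ ∈ A.carrier := by
  simp only [translate, Set.image_mul_right, Set.mem_preimage]

/-- For the miss-condition, thicken `K g⁻¹` to a compact `L` still disjoint from `A`; by compactness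
of `K`, `K h⁻¹ ⊆ L` for all `h` near `g`. -/
theorem continuous_translate [LocallyCompactSpace G] [T2Space G] :
    Continuous fun p : ClosedSubsets G × G => p.1.translate p.2 := by
  refine continuous_generateFrom_iff.mpr ?_
  rintro S (⟨U, hU, rfl⟩ | ⟨K, hK, rfl⟩)
  · rw [isOpen_iff_mem_nhds]
    rintro ⟨A, g⟩ ⟨_, ⟨a, ha, rfl⟩, haU⟩
    have hm : ∀ᶠ q : G × G in 𝓝 a ×ˢ 𝓝 g, q.1 * q.2 ∈ U := by
      rw [← nhds_prod_eq]
      exact continuous_mul.continuousAt.eventually (hU.mem_nhds haU)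
    obtain ⟨pa, hpa, pg, hpg, h⟩ := Filter.eventually_prod_iff.mp hm
    obtain ⟨V, hVa, hV, haV⟩ := mem_nhds_iff.mp hpa
    have h1 : ∀ᶠ C : ClosedSubsets G in 𝓝 A, (C.carrier ∩ V).Nonempty :=
      (isOpen_hit hV).mem_nhds ⟨a, ha, haV⟩
    rw [nhds_prod_eq]
    filter_upwards [h1.prod_mk hpg] with p ⟨⟨b, hb, hbV⟩, hp⟩
    exact ⟨b * p.2, ⟨b, hb, rfl⟩, h (hVa hbV) hp⟩
  · rw [isOpen_iff_mem_nhds]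
    rintro ⟨A, g⟩ hA
    have hsub : (fun k => k * g⁻¹) '' K ⊆ A.carrierᶜ := by
      rintro _ ⟨k, hk, rfl⟩ h
      exact Set.eq_empty_iff_forall_notMem.mp hA k ⟨mem_translate.mpr h, hk⟩
    obtain ⟨L, hL, hKL, hLA⟩ := exists_compact_between
      (hK.image (continuous_mul_const g⁻¹)) A.isClosed.isOpen_compl hsub
    have h1 : ∀ᶠ C : ClosedSubsets G in 𝓝 A, C.carrier ∩ L = ∅ := (isOpen_miss hL).mem_nhds
      (Set.eq_empty_of_forall_notMem fun y hy => hLA hy.2 hy.1)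
    have h2 : ∀ᶠ h in 𝓝 g, ∀ k ∈ K, k * h⁻¹ ∈ interior L := by
      refine hK.eventually_forall_of_forall_eventually fun k hk => ?_
      have hc : Continuous fun q : G × G => q.2 * q.1⁻¹ := by fun_prop
      exact hc.continuousAt.eventually (isOpen_interior.mem_nhds (hKL ⟨k, hk, rfl⟩))
    rw [nhds_prod_eq]
    filter_upwards [h1.prod_mk h2] with p hp
    refine Set.eq_empty_of_forall_notMem fun x ⟨hx, hxK⟩ => ?_
    exact Set.eq_empty_iff_forall_notMem.mp hp.1 _
      ⟨mem_translate.mp hx, interior_subset (hp.2 x hxK)⟩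

end Translate

end ClosedSubsets

/-! ### Local compactness of `Ω` and the translation criterion -/

section Omega

variable {G : Type*} [TopologicalSpace G] [Group G] [IsTopologicalGroup G]
  [SecondCountableTopology G] [MeasurableSpace G] [BorelSpace G] [LocallyCompactSpace G] [T2Space G]
  {μ : Measure G} [μ.IsHaarMeasure]
  {P : Submonoid G} {H : Type*} [NormedAddCommGroup H] [InnerProductSpace ℂ H]
  [CompleteSpace H] {V : P → H →L[ℂ] H}

theorem inv_mul_mem_of_mem_Omega (hP : IsOreSemigroup P) (hV : IsIsometricRep V)
    (hcomm : HasCommutingRangeProjections V) {A : ClosedSubsets G} (hA : A ∈ Omega μ V) {p a : G}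
    (hp : p ∈ P) (ha : a ∈ A.carrier) : p⁻¹ * a ∈ A.carrier := by
  obtain ⟨φ, hφ, -, rfl⟩ := exists_of_mem_Omega hA
  exact inv_mul_mem_functionalSupport hP hV hcomm hφ hp ha

theorem one_mem_of_mem_Omega (hP : IsOreSemigroup P) (hV : IsIsometricRep V)
    {A : ClosedSubsets G} (hA : A ∈ Omega μ V) : 1 ∈ A.carrier := by
  obtain ⟨φ, hφ, h0, rfl⟩ := exists_of_mem_Omega hA
  simpa using inv_mem_functionalSupport hP hV hφ h0 P.one_mem

theorem isCompact_image_functionalSupport (μ : Measure G) [μ.IsHaarMeasure]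
    (hP : IsOreSemigroup P) (hV : IsIsometricRep V) (hcomm : HasCommutingRangeProjections V) :
    IsCompact (functionalSupport '' multiplicativeFunctionals μ V) :=
  isCompact_multiplicativeFunctionals.image_of_continuousOn
    (continuousOn_functionalSupport hP hV hcomm)

/-- A nonzero functional has `1` in its support and zero has empty support, so discarding the empty
set discards exactly the zero functional. The second factor is an open hit-condition. -/
theorem Omega_eq (hP : IsOreSemigroup P) (hV : IsIsometricRep V) :
    Omega μ V = functionalSupport '' multiplicativeFunctionals μ V ∩
      {A | (A.carrier ∩ Set.univ).Nonempty} := by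
  ext A
  constructor
  · intro hA
    obtain ⟨φ, hφ, -, e⟩ := exists_of_mem_Omega hA
    exact ⟨⟨φ, hφ, e⟩, 1, one_mem_of_mem_Omega hP hV hA, trivial⟩
  · rintro ⟨⟨φ, hφ, rfl⟩, hne⟩
    rw [Set.mem_ofPred_eq, Set.inter_univ] at hne
    exact functionalSupport_mem_Omega hφ hne

theorem locallyCompactSpace_Omega (hP : IsOreSemigroup P) (hV : IsIsometricRep V)
    (hcomm : HasCommutingRangeProjections V) : LocallyCompactSpace (Omega μ V) := by
  set S := functionalSupport '' multiplicativeFunctionals μ V with hS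
  have : CompactSpace S :=
    isCompact_iff_compactSpace.mp (isCompact_image_functionalSupport μ hP hV hcomm)
  have hsub : Omega μ V ⊆ S := by rw [Omega_eq hP hV]; exact Set.inter_subset_left
  refine IsOpenEmbedding.locallyCompactSpace (f := Set.inclusion hsub)
    ⟨IsEmbedding.inclusion hsub, ?_⟩
  have e : Set.range (Set.inclusion hsub) =
      Subtype.val ⁻¹' {A : ClosedSubsets G | (A.carrier ∩ Set.univ).Nonempty} := by
    rw [Set.range_inclusion]
    ext A
    change A.1 ∈ Omega μ V ↔ _
    rw [Omega_eq hP hV]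
    exact ⟨fun h => h.2, fun h => ⟨A.2, h⟩⟩
  rw [e]
  exact (ClosedSubsets.isOpen_hit isOpen_univ).preimage continuous_subtype_val

theorem translate_mem_Omega_iff (hP : IsOreSemigroup P) (hV : IsIsometricRep V)
    (hcomm : HasCommutingRangeProjections V) {A : ClosedSubsets G} (hA : A ∈ Omega μ V) (g : G) :
    A.translate g ∈ Omega μ V ↔ g⁻¹ ∈ A.carrier := by
  constructor
  · intro h
    simpa using ClosedSubsets.mem_translate.mp (one_mem_of_mem_Omega hP hV h)
  · intro hg
    set S := functionalSupport '' multiplicativeFunctionals μ V with hS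
    have hSc : IsClosed S := (isCompact_image_functionalSupport μ hP hV hcomm).isClosed
    have hc : Continuous fun s : G => A.translate (g * s) :=
      ClosedSubsets.continuous_translate.comp (by fun_prop : Continuous fun s : G => (A, g * s))
    -- For `s ∈ Int(P)` the interior case applies to `(g s)⁻¹`, as `g⁻¹ (g s) = s`. Letting `s → 1`
    -- stays in the closed set `S`, and `1 ∈ Ag` rules out the empty limit.
    have h1 : interior (P : Set G) ⊆ (fun s : G => A.translate (g * s)) ⁻¹' S := by
      intro s hs
      have h2 : A.translate (s⁻¹ * g⁻¹)⁻¹ ∈ Omega μ V :=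
        translate_inv_mem_Omega_of_interior hP hV hcomm hA hg (by simpa using hs)
      rw [mul_inv_rev, inv_inv, inv_inv, Omega_eq hP hV] at h2
      exact h2.1
    have h3 := closure_minimal h1 (hSc.preimage hc) (one_mem_closure_interior hP)
    rw [Set.mem_preimage, mul_one] at h3
    rw [Omega_eq hP hV]
    exact ⟨h3, 1, ClosedSubsets.mem_translate.mpr (by simpa using hg), trivial⟩

end Omega

/-! ### Null boundary of `P⁻¹`-invariant closed sets -/

section NullBoundary

variable {G : Type*} [TopologicalSpace G] [Group G] [IsTopologicalGroup G]
  [SecondCountableTopology G] [MeasurableSpace G] [BorelSpace G] [LocallyCompactSpace G] [T2Space G]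
  {P : Submonoid G}

/-- Take an open `U ⊇ C` with `μ(U) ≤ μ(C) + ε`. For `s ∈ Int(P)` close to `1`, the translate `s⁻¹
C` has the measure of `C` and lies in `U ∩ B`, which leaves at most `ε` for `U \ B ⊇ C \ B`. -/
theorem measure_isCompact_diff_eq_zero (μ : Measure G) [μ.IsHaarMeasure] (hP : IsOreSemigroup P)
    {C B : Set G} (hC : IsCompact C) (hB : IsOpen B)
    (h : ∀ s ∈ interior (P : Set G), ∀ a ∈ C, s⁻¹ * a ∈ B) : μ (C \ B) = 0 := by
  refine le_antisymm (ENNReal.le_of_forall_pos_le_add fun ε hε _ => ?_) zero_le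
  rw [zero_add]
  obtain ⟨U, hCU, hU, hμU⟩ := hC.exists_isOpen_lt_add (μ := μ) (ENNReal.coe_pos.mpr hε).ne'
  have hev : ∀ᶠ s in 𝓝 (1 : G), ∀ a ∈ C, s⁻¹ * a ∈ U := by
    refine hC.eventually_forall_of_forall_eventually fun a ha => ?_
    have hc : Continuous fun q : G × G => q.1⁻¹ * q.2 := by fun_prop
    exact hc.continuousAt.eventually (hU.mem_nhds (by simpa using hCU ha))
  obtain ⟨s, hsU, hs⟩ := mem_closure_iff_nhds.mp (one_mem_closure_interior hP) _ hev
  have hsub : (fun x => s * x) ⁻¹' C ⊆ U ∩ B := fun x hx => by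
    have h1 := hsU _ hx
    have h2 := h s hs _ hx
    rw [inv_mul_cancel_left] at h1 h2
    exact ⟨h1, h2⟩
  have hCfin : μ C ≠ ⊤ := hC.measure_lt_top.ne
  have hle : μ C + μ (C \ B) ≤ μ C + ε := by
    calc μ C + μ (C \ B) ≤ μ (U ∩ B) + μ (U \ B) := by
          refine add_le_add ?_ (measure_mono (Set.sdiff_subset_sdiff_left hCU))
          rw [← measure_preimage_mul μ s C]
          exact measure_mono hsub
      _ = μ U := measure_inter_add_sdiff U hB.measurableSet
      _ ≤ μ C + ε := hμU.le
  exact (ENNReal.add_le_add_iff_left hCfin).mp hle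

/-- The boundary of a closed set stable under left multiplication by `P⁻¹` is a null set. -/
theorem measure_isClosed_diff_eq_zero (μ : Measure G) [μ.IsHaarMeasure] (hP : IsOreSemigroup P)
    {A B : Set G} (hA : IsClosed A) (hB : IsOpen B)
    (h : ∀ s ∈ interior (P : Set G), ∀ a ∈ A, s⁻¹ * a ∈ B) : μ (A \ B) = 0 := by
  refine measure_null_of_locally_null _ fun x _ => ?_
  obtain ⟨K, hK, hxK⟩ := exists_compact_mem_nhds x
  refine ⟨(A ∩ K) \ B, ?_, measure_isCompact_diff_eq_zero μ hP (hK.inter_left hA) hB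
    fun s hs a ha => h s hs a ha.1⟩
  filter_upwards [mem_nhdsWithin_of_mem_nhds hxK, self_mem_nhdsWithin] with y hy hy'
  exact ⟨⟨hy'.1, hy⟩, hy'.2⟩

end NullBoundary

/-! ### The groupoid and its Haar system, for any `X` satisfying the translation criterion -/

namespace Semidirect

variable {G : Type*} [TopologicalSpace G] [Group G] [IsTopologicalGroup G]
  {P : Submonoid G} {X : Set (ClosedSubsets G)}

theorem isInducing : IsInducing fun γ : Semidirect P X => (γ.fst, γ.snd) := ⟨rfl⟩

theorem isEmbedding : IsEmbedding fun γ : Semidirect P X => (γ.fst, γ.snd) :=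
  ⟨isInducing, fun _ _ h => Semidirect.ext congr($h.1) congr($h.2)⟩

theorem continuous_fst : Continuous fun γ : Semidirect P X => γ.fst :=
  _root_.continuous_fst.comp isInducing.continuous

theorem continuous_snd : Continuous fun γ : Semidirect P X => γ.snd :=
  _root_.continuous_snd.comp isInducing.continuous

theorem continuous_iff {Y : Type*} [TopologicalSpace Y] {f : Y → Semidirect P X} :
    Continuous f ↔ Continuous (fun y => (f y).fst) ∧ Continuous fun y => (f y).snd := by
  rw [isInducing.continuous_iff, ← continuous_prodMk]
  rfl

theorem isArrow_iff (hP : IsOreSemigroup P)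
    (hX : ∀ A ∈ X, ∀ g, A.translate g ∈ X ↔ g⁻¹ ∈ A.carrier) (x : X) (g : G) :
    IsArrow P x g ↔ g⁻¹ ∈ x.1.carrier := by
  rw [← hX x.1 x.2]
  exact ⟨fun h => source_mem (⟨x, g, h⟩ : Semidirect P X), isArrow_of_translate_mem hP x g⟩

variable [LocallyCompactSpace G] [T2Space G]

theorem continuous_source : Continuous fun γ : Semidirect P X => γ.source :=
  (ClosedSubsets.continuous_translate.comp
    ((continuous_subtype_val.comp continuous_fst).prodMk continuous_snd)).subtype_mk _

theorem isClosedEmbedding (hP : IsOreSemigroup P)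
    (hX : ∀ A ∈ X, ∀ g, A.translate g ∈ X ↔ g⁻¹ ∈ A.carrier) :
    IsClosedEmbedding fun γ : Semidirect P X => (γ.fst, γ.snd) := by
  refine ⟨isEmbedding, ?_⟩
  have e : Set.range (fun γ : Semidirect P X => (γ.fst, γ.snd)) =
      {p : X × G | p.2⁻¹ ∈ p.1.1.carrier} := by
    ext p
    constructor
    · rintro ⟨γ, rfl⟩
      exact (isArrow_iff hP hX _ _).mp γ.isArrow
    · exact fun h => ⟨⟨p.1, p.2, (isArrow_iff hP hX _ _).mpr h⟩, rfl⟩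
  rw [e, ← isOpen_compl_iff, isOpen_iff_mem_nhds]
  intro p hp
  have hc : Continuous fun p : X × G => (p.1.1, p.2⁻¹) := by fun_prop
  exact hc.continuousAt.eventually (ClosedSubsets.eventually_notMem hp)

instance : T2Space (Semidirect P X) := isEmbedding.t2Space

theorem isLocallyCompactGroupoid (hP : IsOreSemigroup P)
    (hX : ∀ A ∈ X, ∀ g, A.translate g ∈ X ↔ g⁻¹ ∈ A.carrier) [LocallyCompactSpace X] :
    (groupoid hP X).IsLocallyCompactGroupoid where
  locallyCompact := (isClosedEmbedding hP hX).locallyCompactSpace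
  hausdorff := inferInstance
  continuous_r := continuous_fst
  continuous_s := continuous_source
  continuous_unit := continuous_iff.mpr ⟨continuous_id, continuous_const⟩
  continuous_inv := continuous_iff.mpr ⟨continuous_source, continuous_snd.inv⟩
  continuous_mul := by
    have h1 : Continuous fun p : {p : Semidirect P X × Semidirect P X //
        (groupoid hP X).s p.1 = (groupoid hP X).r p.2} => p.1.1 := by fun_prop
    have h2 : Continuous fun p : {p : Semidirect P X × Semidirect P X //
        (groupoid hP X).s p.1 = (groupoid hP X).r p.2} => p.1.2 := by fun_prop
    have h3 := continuous_fst.comp h1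
    have h4 := (continuous_snd.comp h1).mul (continuous_snd.comp h2)
    exact continuous_iff.mpr ⟨h3, h4⟩

theorem isClosed_Q (hP : IsOreSemigroup P)
    (hX : ∀ A ∈ X, ∀ g, A.translate g ∈ X ↔ g⁻¹ ∈ A.carrier) (x : X) : IsClosed (Q P x) := by
  have e : Q P x = (fun g => g⁻¹) ⁻¹' x.1.carrier := Set.ext fun g => isArrow_iff hP hX x g
  rw [e]
  exact x.1.isClosed.preimage continuous_inv

/-- The inclusion of `Q_x` as the fibre over `x`. -/
def fibre (P : Submonoid G) (x : X) (g : Q P x) : Semidirect P X := ⟨x, g.1, g.2⟩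

theorem continuous_fibre (x : X) : Continuous (fibre P x) :=
  continuous_iff.mpr ⟨continuous_const, continuous_subtype_val⟩

theorem isClosedEmbedding_fibre (x : X) : IsClosedEmbedding (fibre P x) := by
  refine ⟨IsEmbedding.of_comp (continuous_fibre x) isEmbedding.continuous
    ((isEmbedding_prodMkRight x).comp .subtypeVal), ?_⟩
  have e : Set.range (fibre P x) = {γ | γ.fst = x} := by
    ext γ
    constructor
    · rintro ⟨g, rfl⟩
      rfl
    · rintro rfl
      exact ⟨⟨γ.snd, γ.isArrow⟩, rfl⟩
  rw [e]
  exact isClosed_singleton.preimage continuous_fst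

variable [MeasurableSpace G] [BorelSpace G] {μ : Measure G}

theorem fibreMeasure_apply (hP : IsOreSemigroup P)
    (hX : ∀ A ∈ X, ∀ g, A.translate g ∈ X ↔ g⁻¹ ∈ A.carrier) (x : X) (S : Set (Semidirect P X)) :
    fibreMeasure P μ x S = μ ((↑) '' (fibre P x ⁻¹' S)) := by
  change (μ.comap ((↑) : Q P x → G)).map (fibre P x) S = _
  rw [(isClosedEmbedding_fibre x).measurableEmbedding.map_apply,
    comap_subtype_coe_apply (isClosed_Q hP hX x).measurableSet]

open Classical in
/-- The restriction of a function on `X ⋊ P` to the fibre over `x`, extended by zero to `G`. -/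
def fibreFun (f : Semidirect P X → ℂ) (x : X) (g : G) : ℂ :=
  if h : IsArrow P x g then f ⟨x, g, h⟩ else 0

theorem fibreFun_of_isArrow (f : Semidirect P X → ℂ) {x : X} {g : G} (h : IsArrow P x g) :
    fibreFun f x g = f ⟨x, g, h⟩ := dif_pos h

theorem fibreFun_of_not_isArrow (f : Semidirect P X → ℂ) {x : X} {g : G} (h : ¬ IsArrow P x g) :
    fibreFun f x g = 0 := dif_neg h

/-- Extension by zero moves all fibre integrals to the one measure `μ`, so that only the integrand
depends on `x`. -/
theorem integral_fibreMeasure (hP : IsOreSemigroup P)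
    (hX : ∀ A ∈ X, ∀ g, A.translate g ∈ X ↔ g⁻¹ ∈ A.carrier) (x : X) (f : Semidirect P X → ℂ) :
    ∫ γ, f γ ∂(fibreMeasure P μ x) = ∫ g, fibreFun f x g ∂μ := by
  change ∫ γ, f γ ∂((μ.comap ((↑) : Q P x → G)).map (fibre P x)) = _
  rw [(isClosedEmbedding_fibre x).measurableEmbedding.integral_map]
  have e : ∀ g : Q P x, f (fibre P x g) = fibreFun f x g := fun g =>
    (fibreFun_of_isArrow f g.2).symm
  simp_rw [e]
  rw [integral_subtype_comap (isClosed_Q hP hX x).measurableSet (fibreFun f x)]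
  exact setIntegral_eq_integral_of_forall_compl_eq_zero fun g hg => fibreFun_of_not_isArrow f hg

variable [SecondCountableTopology G] [μ.IsHaarMeasure]

theorem regular_fibreMeasure (hP : IsOreSemigroup P)
    (hX : ∀ A ∈ X, ∀ g, A.translate g ∈ X ↔ g⁻¹ ∈ A.carrier) [LocallyCompactSpace X] (x : X) :
    (fibreMeasure P μ x).Regular := by
  have : LocallyCompactSpace (Semidirect P X) := (isClosedEmbedding hP hX).locallyCompactSpace
  have : SecondCountableTopology (Semidirect P X) := isEmbedding.secondCountableTopology
  have : TopologicalSpace.MetrizableSpace (Semidirect P X) :=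
    TopologicalSpace.metrizableSpace_of_t3_secondCountable _
  have : IsFiniteMeasureOnCompacts (fibreMeasure P μ x) := ⟨fun K hK => by
    rw [fibreMeasure_apply hP hX]
    exact (((isClosedEmbedding_fibre x).isCompact_preimage hK).image
      continuous_subtype_val).measure_lt_top⟩
  have : IsLocallyFiniteMeasure (fibreMeasure P μ x) :=
    isLocallyFiniteMeasure_of_isFiniteMeasureOnCompacts
  infer_instance

/-- `P⁻¹ A ⊆ A` means `Q_A P ⊆ Q_A`. Hence every neighbourhood of `g ∈ Q_A` meets `g Int(P) ⊆ Q_A`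
in a nonempty open set, which has positive Haar measure. -/
theorem support_fibreMeasure (hP : IsOreSemigroup P)
    (hX : ∀ A ∈ X, ∀ g, A.translate g ∈ X ↔ g⁻¹ ∈ A.carrier)
    (hXP : ∀ A ∈ X, ∀ p ∈ P, ∀ a ∈ A.carrier, p⁻¹ * a ∈ A.carrier) (x : X) :
    (fibreMeasure P μ x).support = {γ | γ.fst = x} := by
  ext γ
  rw [Measure.mem_support_iff_forall]
  constructor
  · intro h
    by_contra hγ
    have h1 := h {η | η.fst ≠ x}
      ((isClosed_singleton.isOpen_compl.preimage continuous_fst).mem_nhds hγ)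
    rw [fibreMeasure_apply hP hX] at h1
    have h2 : fibre P x ⁻¹' {η | η.fst ≠ x} = ∅ :=
      Set.eq_empty_of_forall_notMem fun g hg => hg rfl
    simp [h2] at h1
  · rintro rfl U hU
    rw [fibreMeasure_apply hP hX]
    obtain ⟨O, hO, hOU⟩ := (mem_nhds_subtype _ _ _).mp
      ((continuous_fibre γ.fst).continuousAt (x := ⟨γ.snd, γ.isArrow⟩) hU)
    obtain ⟨O', hO'O, hO', hγO'⟩ := mem_nhds_iff.mp hO
    obtain ⟨s, hs, hsO⟩ := exists_mem_interior_mul_mem hP hO' hγO'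
    have hW : IsOpen (O' ∩ {w | γ.snd⁻¹ * w ∈ interior (P : Set G)}) :=
      hO'.inter (isOpen_interior.preimage (by fun_prop))
    refine (hW.measure_pos μ ⟨γ.snd * s, hsO, by simpa using hs⟩).trans_le (measure_mono ?_)
    rintro w ⟨hwO, hw⟩
    have hwQ : w ∈ Q P γ.fst := by
      refine (isArrow_iff hP hX _ _).mpr ?_
      have := hXP _ γ.fst.2 _ (interior_subset hw) _ ((isArrow_iff hP hX _ _).mp γ.isArrow)
      rwa [mul_inv_rev, inv_inv, mul_inv_cancel_right] at this
    exact ⟨⟨w, hwQ⟩, hOU (hO'O hwO), rfl⟩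

/-- If `g⁻¹ ∈ Int(P)⁻¹ x₀`, being an arrow at `g` persists for `x` near `x₀` by a hit-condition; if
`g⁻¹ ∉ x₀`, not being one persists by a miss-condition. The set left over is the inverse of a null
boundary. -/
theorem ae_continuousAt_fibreFun (hP : IsOreSemigroup P)
    (hX : ∀ A ∈ X, ∀ g, A.translate g ∈ X ↔ g⁻¹ ∈ A.carrier)
    (hXP : ∀ A ∈ X, ∀ p ∈ P, ∀ a ∈ A.carrier, p⁻¹ * a ∈ A.carrier) {f : Semidirect P X → ℂ}
    (hf : Continuous f) (x₀ : X) :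
    ∀ᵐ g ∂μ, ContinuousAt (fun x => fibreFun f x g) x₀ := by
  set B : Set G := ⋃ a ∈ x₀.1.carrier, {y | a * y⁻¹ ∈ interior (P : Set G)} with hBdef
  have hB : IsOpen B := isOpen_biUnion fun a _ => isOpen_interior.preimage (by fun_prop)
  have hnull : μ (x₀.1.carrier \ B) = 0 := by
    refine measure_isClosed_diff_eq_zero μ hP x₀.1.isClosed hB fun s hs a ha => ?_
    refine Set.mem_biUnion ha ?_
    rwa [Set.mem_ofPred_eq, mul_inv_rev, inv_inv, mul_inv_cancel_left]
  have hnull' : μ (x₀.1.carrier \ B)⁻¹ = 0 := (measure_inv_null μ).mpr hnull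
  filter_upwards [measure_eq_zero_iff_ae_notMem.mp hnull'] with g hg
  by_cases hgx : g⁻¹ ∈ x₀.1.carrier
  · have hgB : g⁻¹ ∈ B := by
      by_contra h
      exact hg ⟨hgx, h⟩
    obtain ⟨a, ha, hag⟩ := Set.mem_iUnion₂.mp hgB
    rw [Set.mem_ofPred_eq, inv_inv] at hag
    set N : Set X := {x | IsArrow P x g} with hN
    have hNn : N ∈ 𝓝 x₀ := by
      have h1 : IsOpen {y : G | y * g ∈ interior (P : Set G)} :=
        isOpen_interior.preimage (by fun_prop)
      have h2 := ((ClosedSubsets.isOpen_hit h1).preimage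
        (continuous_subtype_val (p := (· ∈ X)))).mem_nhds (x := x₀) ⟨a, ha, hag⟩
      filter_upwards [h2] with x ⟨b, hb, hbg⟩
      refine (isArrow_iff hP hX _ _).mpr ?_
      have := hXP _ x.2 _ (interior_subset hbg) _ hb
      rwa [mul_inv_rev, inv_mul_cancel_right] at this
    refine ContinuousOn.continuousAt (s := N) ?_ hNn
    rw [continuousOn_iff_continuous_domRestrict]
    have e : N.domRestrict (fun x => fibreFun f x g) = fun x : N => f ⟨x.1, g, x.2⟩ :=
      funext fun x => fibreFun_of_isArrow f x.2
    rw [e]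
    exact hf.comp (continuous_iff.mpr ⟨continuous_subtype_val, continuous_const⟩)
  · have hc : Continuous fun x : X => (x.1, g⁻¹) := by fun_prop
    have h1 : ∀ᶠ x : X in 𝓝 x₀, g⁻¹ ∉ x.1.carrier :=
      hc.continuousAt.eventually (ClosedSubsets.eventually_notMem hgx)
    refine (continuousAt_const (y := (0 : ℂ))).congr ?_
    filter_upwards [h1] with x hx
    exact (fibreFun_of_not_isArrow f fun h => hx ((isArrow_iff hP hX _ _).mp h)).symm

theorem continuous_integral_fibreMeasure (hP : IsOreSemigroup P)
    (hX : ∀ A ∈ X, ∀ g, A.translate g ∈ X ↔ g⁻¹ ∈ A.carrier)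
    (hXP : ∀ A ∈ X, ∀ p ∈ P, ∀ a ∈ A.carrier, p⁻¹ * a ∈ A.carrier) {f : Semidirect P X → ℂ}
    (hf : Continuous f) (hfc : HasCompactSupport f) :
    Continuous fun x => ∫ γ, f γ ∂(fibreMeasure P μ x) := by
  simp_rw [integral_fibreMeasure hP hX]
  obtain ⟨C, hC⟩ := hf.bounded_above_of_compact_support hfc
  -- The projection of the support of `f` to `G` is compact, so `C` on `K` is an integrable bound
  -- valid for all `x`.
  set K : Set G := (fun γ : Semidirect P X => γ.snd) '' tsupport f with hK
  have hKc : IsCompact K := hfc.isCompact.image continuous_snd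
  rw [continuous_iff_continuousAt]
  intro x₀
  refine continuousAt_of_dominated (bound := K.indicator fun _ => C)
    (Filter.Eventually.of_forall fun x => ?_)
    (Filter.Eventually.of_forall fun x => Filter.Eventually.of_forall fun g => ?_) ?_
    (ae_continuousAt_fibreFun hP hX hXP hf x₀)
  · have e : fibreFun f x = (Q P x).indicator (fibreFun f x) := by
      refine (Set.indicator_eq_self.mpr fun g hg => ?_).symm
      by_contra h
      exact hg (fibreFun_of_not_isArrow f h)
    rw [e, aestronglyMeasurable_indicator_iff (isClosed_Q hP hX x).measurableSet]
    refine ContinuousOn.aestronglyMeasurable ?_ (isClosed_Q hP hX x).measurableSet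
    rw [continuousOn_iff_continuous_domRestrict]
    have e' : (Q P x).domRestrict (fibreFun f x) = fun g => f (fibre P x g) :=
      funext fun g => fibreFun_of_isArrow f g.2
    rw [e']
    exact hf.comp (continuous_fibre x)
  · by_cases h : IsArrow P x g
    · rw [fibreFun_of_isArrow f h]
      by_cases h0 : f ⟨x, g, h⟩ = 0
      · rw [h0, norm_zero]
        exact Set.indicator_nonneg (fun _ _ => (norm_nonneg _).trans (hC ⟨x, g, h⟩)) _
      · rw [Set.indicator_of_mem (show g ∈ K from ⟨⟨x, g, h⟩, subset_closure h0, rfl⟩)]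
        exact hC _
    · rw [fibreFun_of_not_isArrow f h, norm_zero]
      refine Set.indicator_nonneg (fun _ hg => ?_) _
      obtain ⟨γ, -, -⟩ := hg
      exact (norm_nonneg _).trans (hC γ)
  · exact (integrable_indicator_iff hKc.measurableSet).mpr
      (integrableOn_const hKc.measure_lt_top.ne)

theorem integral_mul_left_fibreMeasure (hP : IsOreSemigroup P)
    (hX : ∀ A ∈ X, ∀ g, A.translate g ∈ X ↔ g⁻¹ ∈ A.carrier) (γ : Semidirect P X)
    (f : Semidirect P X → ℂ)
    [hd : ∀ η, Decidable ((groupoid hP X).s γ = (groupoid hP X).r η)] :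
    ∫ η, (if h : (groupoid hP X).s γ = (groupoid hP X).r η then f ((groupoid hP X).mul γ η h)
      else 0) ∂(fibreMeasure P μ ((groupoid hP X).s γ))
      = ∫ η, f η ∂(fibreMeasure P μ ((groupoid hP X).r γ)) := by
  rw [integral_fibreMeasure hP hX, integral_fibreMeasure hP hX,
    ← integral_mul_left_eq_self (μ := μ) (fibreFun f ((groupoid hP X).r γ)) γ.snd]
  congr 1 with g
  -- This is `Q_{s(γ)} = γ.snd⁻¹ Q_{r(γ)}`: the two extensions by zero match under left translation.
  have hiff : IsArrow P γ.source g ↔ IsArrow P γ.fst (γ.snd * g) := by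
    rw [isArrow_iff hP hX, isArrow_iff hP hX, mul_inv_rev]
    exact ClosedSubsets.mem_translate
  change fibreFun _ γ.source g = fibreFun f γ.fst (γ.snd * g)
  by_cases h : IsArrow P γ.source g
  · rw [fibreFun_of_isArrow _ h, fibreFun_of_isArrow _ (hiff.mp h)]
    exact dif_pos rfl
  · rw [fibreFun_of_not_isArrow _ h, fibreFun_of_not_isArrow _ fun h' => h (hiff.mpr h')]

theorem isHaarSystem (hP : IsOreSemigroup P)
    (hX : ∀ A ∈ X, ∀ g, A.translate g ∈ X ↔ g⁻¹ ∈ A.carrier)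
    (hXP : ∀ A ∈ X, ∀ p ∈ P, ∀ a ∈ A.carrier, p⁻¹ * a ∈ A.carrier) [LocallyCompactSpace X] :
    (groupoid hP X).IsHaarSystem (fun x => fibreMeasure P μ x) where
  regular := regular_fibreMeasure hP hX
  support_eq := support_fibreMeasure hP hX hXP
  continuous_integral _ := continuous_integral_fibreMeasure hP hX hXP
  left_invariant γ f _ _ := integral_mul_left_fibreMeasure hP hX γ f
    (hd := fun _ => Classical.propDecidable _)

end Semidirect

end IsometricRep

end

theorem proposition5p2
    {G : Type*} [TopologicalSpace G] [Group G] [IsTopologicalGroup G] [LocallyCompactSpace G]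
    [T2Space G] [SecondCountableTopology G] [MeasurableSpace G] [BorelSpace G]
    (μ : Measure G) [μ.IsHaarMeasure]
    (P : Submonoid G) (hP : IsometricRep.IsOreSemigroup P)
    {H : Type*} [NormedAddCommGroup H] [InnerProductSpace ℂ H] [CompleteSpace H]
    (V : P → H →L[ℂ] H) (hV : IsometricRep.IsIsometricRep V)
    (hcomm : IsometricRep.HasCommutingRangeProjections V) :
    (∀ A ∈ IsometricRep.Omega μ V, ∀ g : G,
      A.translate g ∈ IsometricRep.Omega μ V ↔ g⁻¹ ∈ A.carrier) ∧
    (IsometricRep.Semidirect.groupoid hP (IsometricRep.Omega μ V)).IsLocallyCompactGroupoid ∧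
    (IsometricRep.Semidirect.groupoid hP (IsometricRep.Omega μ V)).IsHaarSystem
      (fun A => IsometricRep.Semidirect.fibreMeasure P μ A) := by
  have hX : ∀ A ∈ IsometricRep.Omega μ V, ∀ g : G,
      A.translate g ∈ IsometricRep.Omega μ V ↔ g⁻¹ ∈ A.carrier := fun _ hA =>
    IsometricRep.translate_mem_Omega_iff hP hV hcomm hA
  have := IsometricRep.locallyCompactSpace_Omega (μ := μ) hP hV hcomm
  exact ⟨hX, IsometricRep.Semidirect.isLocallyCompactGroupoid hP hX,
    IsometricRep.Semidirect.isHaarSystem hP hX fun _ hA _ hp _ =>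
      IsometricRep.inv_mul_mem_of_mem_Omega hP hV hcomm hA hp⟩
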